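/- **Setting.** Let $p$ be an odd prime, $k$ an algebraically closed field of characteristic $p$ (for instance $\overline{\mathbb F}_p$), $W=W(k)$, $K=W[1/p]$. Let $\epsilon\in\mathbb Z_p^\times$ be the Teichmüller lift of a nonsquare of $\mathbb F_p$, $\lambda\in W^\times$ a Teichmüller element with $\lambda^2=\epsilon$; the constants $2,4$ in $\frac{z}{2\epsilon}$, $\frac{z^2}{4\epsilon}$ and the like are Teichmüller lifts. Let $\sigma$ be the Frobenius on $W$ extended to $W[[x,y,z]]$ by $x,y,z\mapsto x^p,y^p,z^p$, and $M^{[i]}=\sigma^i(M)$. Put $$\alpha_{i,j}=x^{[i]}y^{[j]}+x^{[j]}y^{[i]}+\tfrac{z^{[i]}z^{[j]}}{2\epsilon},\qquad \beta_i=x^{[i]}y^{[i]}+\tfrac{(z^{[i]})^2}{4\epsilon},$$ $$E=\beta_0\begin{bmatrix}1&-\frac1\lambda\\ \lambda&-1\end{bmatrix},\quad C=\begin{bmatrix}\frac x\lambda&\frac y\lambda&\frac z\lambda\\ x&y&z\end{bmatrix},\quad B=\begin{bmatrix}\lambda y&-y\\ \lambda x&-x\\ \frac{\lambda z}{2\epsilon}&-\frac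 z{2\epsilon}\end{bmatrix},\quad F=\begin{bmatrix}\frac1{2p}E&\frac1{2p}C\\ B&0\end{bmatrix}.$$ $\mathrm{Spf}\,W[[x,y,z]]$ is the formal deformation space, at a superspecial point $P$, of principally polarized abelian surfaces; the module $\mathbf L$ of special endomorphisms of the crystalline realization has a $W$-basis $v_1,\dots,v_5$, and $\omega_1=\lambda(pv_1-v_3)$, $\omega_2=pv_1+v_3$, $\omega_3=v_2$, $\omega_4=v_4$, $\omega_5=v_5$ span over $\mathbb Z_p$ the lattice of special endomorphisms of the $p$-divisible group at $P$; in the basis $\omega_1,\dots,\omega_5$ the Frobenius on the universal crystal is $(I+F)\sigma$. *Loci $\mathcal D_n(\omega)$.* An admissible index system $(\mathbf I,\mathbf J)$ of length $N$ is a sequence of $N$ blocks, each a single index $j$ (an element of $\mathbf J$) or a pair $i<j$ (two elements of $\mathbf I$), such that the last index of each block is smaller than, and of parity different from, the first index of the next block. $A^{(\mathbf I,\mathbf J)}$ is the product, in increasing order, of $E^{[j]}$ for each single block and $C^{[i]}B^{[j]}$ for each pair. Let $X_{N,\mathrm{even}}$ be the sum of $A^{(\mathbf I,\mathbf J)}$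 over admissible systems of length $N$ with even smallest index, and $Y_{N,\mathrm{even}}$ the sum of $A^{(\mathbf I,\mathbf J)}C^{[j]}$ over the admissible systems $(\mathbf I,\mathbf J,j)$ of length $N$ (blocks of $(\mathbf I,\mathbf J)$ followed by a single final block $j$, which counts in the length) with even smallest index. For $\omega=\sum_j a_j\omega_j$, $a_j\in\mathbb Z_p$ with Teichmüller digits $a_j=\sum_{\kappa\ge0}a_{j,\kappa}p^\kappa$, and $n\ge1$, let $G^1_{n,\mathrm{even}}(\omega)\in W[[x,y,z]]$ be the first entry of $\sum_{\kappa\ge0}2^{-(n+\kappa)}[X_{n+\kappa,\mathrm{even}}\;\,Y_{n+\kappa,\mathrm{even}}](a_{1,\kappa},\dots,a_{5,\kappa})^T$. Let $\mathcal D_n(\omega)\subset\mathrm{Spf}\,k[[x,y,z]]$ be cut out by $G^1_{n,\mathrm{even}}(\omega)\bmod p$. *Curves.* A formal curve $\hat C:\mathrm{Spf}\,k[[t]]\to\mathrm{Spf}\,k[[x,y,z]]$ is a triple $x(t),y(t),z(t)\in t\,k[[t]]$; its intersection number with $g=0$ is $\mathrm{ord}_t\,g(x(t),y(t),z(t))\in\mathbb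 N\cup\{\infty\}$ (for $g\in W[[x,y,z]]$, reduce mod $p$). Let $A=\hat C\cdot\alpha_{0,1}$, $B=\hat C\cdot\beta_0$ (from here on $B$ denotes this number), $d=\hat C\cdot\mathcal D_1(\omega)$ and, for $e\ge0$, $H_e=A(1+p^{2e-1})+p^{2e-1}(p^2-1)d$. The curve $\hat C$ is generically ordinary, almost ordinary or supersingular if the smallest Newton slope of the $F$-isocrystal with Frobenius $(I+F)\sigma$, pulled back to $W(k((t))^{\mathrm{perf}})[1/p]$ by $x,y,z\mapsto[x(t)],[y(t)],[z(t)]$, is $-1$, $-\frac12$ or $0$ respectively. *Lifting.* For $N\ge 1$, $\omega$ lifts to $k[[t]]/(t^N)$ along $\hat C$ if for every lift of $\hat C$ to $(\tilde x,\tilde y,\tilde z)\in (t\,W[[t]])^3$, the pullback of $\prod_{i\ge0}(I+F^{[i]})\,\omega$ lies in $\mathbf L\otimes_W\hat D_N$, where $\hat D_N\subset K[[t]]$ is the $p$-adically completed divided power envelope of $(p,t^N)\subset W[[t]]$. It never decays along $\hat C$ if it lifts to $k[[t]]/(t^N)$ for all $N\ge1$. **Proposition.** Let $\omega\in\bigoplus_j\mathbb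 Z_p\omega_j$ and let $\hat C$ be a formal curve. 1. If $\hat C$ is generically supersingular, then $p\omega$ never decays along $\hat C$; moreover $\hat C\cdot\mathcal D_1(p\omega)=\infty$ and $\hat C\cdot\mathcal D_{n+1}(\omega)=\infty$ for all $n\ge1$. 2. If $\hat C$ is generically almost ordinary, then for all $n\ge0$ $$\hat C\cdot\mathcal D_{n+1}(\omega)=A(1+p^2+\dots+p^{2n-2})+d\,p^{2n}.$$ 3. If $\hat C$ is generically ordinary and $e\ge0$ is such that $H_e\le(1+p)B<H_{e+1}$, then, with $D=\hat C\cdot\mathcal D_{e+1}(\omega)$, $$\hat C\cdot\mathcal D_{n+1}(\omega)=\begin{cases}A(1+p^2+\dots+p^{2n-2})+d\,p^{2n},&0\le n\le e-1,\\ B(1+p+\dots+p^{n-e-1})+D\,p^{n-e},&n\ge e.\end{cases}$$ Moreover $D\ge A(1+p^2+\dots+p^{2e-2})+d\,p^{2e}$, with equality if $(1+p)B>H_e$. (Sums with no terms are $0$; all identities are in $\mathbb N\cup\{\infty\}$.) -/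

import Mathlib

open scoped ENNReal PowerSeries Topology

namespace SuperspecialDecay

noncomputable section

/-! ### Constants, and the series `α_{i,j}`, `β_i`

Throughout `k` is a field of characteristic `p`, `W = WittVector p k`, and `lam : k` is a square root
of a nonsquare `ε` of `𝔽_p`; the constant `ε` is written `lam ^ 2`.  All constants are Teichmüller
lifts.  The objects below are needed in several rings `R` over `W`, so they are defined for a ring
homomorphism `f : W →+* R` and a triple `v = (x, y, z)` of elements of `R`; the twist `[i]` is the
`i`-th power of the Frobenius on constants and replaces `x, y, z` by `x^(p^i), y^(p^i), z^(p^i)`. -/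

/-- The index set of the basis `ω₁, ω₂ | ω₃, ω₄, ω₅`. -/
abbrev Idx : Type := Fin 2 ⊕ Fin 3

section series

variable (p : ℕ) [Fact p.Prime] {k : Type*} [Field k] [CharP k p] {R : Type*} [CommRing R]

/-- `α_{i,j} = x^[i] y^[j] + x^[j] y^[i] + z^[i] z^[j] / (2ε)`. -/
def alpha (lam : k) (f : WittVector p k →+* R) (v : Fin 3 → R) (i j : ℕ) : R :=
  v 0 ^ p ^ i * v 1 ^ p ^ j + v 0 ^ p ^ j * v 1 ^ p ^ i
    + f (WittVector.teichmuller p (2 * lam ^ 2)⁻¹) * (v 2 ^ p ^ i * v 2 ^ p ^ j)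

/-- `β_i = x^[i] y^[i] + (z^[i])² / (4ε)`. -/
def beta (lam : k) (f : WittVector p k →+* R) (v : Fin 3 → R) (i : ℕ) : R :=
  v 0 ^ p ^ i * v 1 ^ p ^ i
    + f (WittVector.teichmuller p (4 * lam ^ 2)⁻¹) * (v 2 ^ p ^ i) ^ 2

/-- `λ^[i]`. -/
def lamTwist (lam : k) (f : WittVector p k →+* R) (i : ℕ) : R :=
  f (WittVector.teichmuller p (lam ^ p ^ i))

/-- `(1/λ)^[i]`. -/
def lamInvTwist (lam : k) (f : WittVector p k →+* R) (i : ℕ) : R :=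
  f (WittVector.teichmuller p (lam⁻¹ ^ p ^ i))

/-- `1/2` in the Witt vectors (where `2` is a unit because `p` is odd). -/
def half : WittVector p k := Ring.inverse 2

/-- The `2 × 2` matrix `E^[i]`. -/
def matE (lam : k) (f : WittVector p k →+* R) (v : Fin 3 → R) (i : ℕ) :
    Matrix (Fin 2) (Fin 2) R :=
  beta p lam f v i • !![1, -lamInvTwist p lam f i; lamTwist p lam f i, -1]

/-- The `2 × 3` matrix `C^[i]`. -/
def matC (lam : k) (f : WittVector p k →+* R) (v : Fin 3 → R) (i : ℕ) :
    Matrix (Fin 2) (Fin 3) R :=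
  !![lamInvTwist p lam f i * v 0 ^ p ^ i, lamInvTwist p lam f i * v 1 ^ p ^ i,
      lamInvTwist p lam f i * v 2 ^ p ^ i;
    v 0 ^ p ^ i, v 1 ^ p ^ i, v 2 ^ p ^ i]

/-- The `3 × 2` matrix `B^[i]`. -/
def matB (lam : k) (f : WittVector p k →+* R) (v : Fin 3 → R) (i : ℕ) :
    Matrix (Fin 3) (Fin 2) R :=
  !![lamTwist p lam f i * v 1 ^ p ^ i, -v 1 ^ p ^ i;
    lamTwist p lam f i * v 0 ^ p ^ i, -v 0 ^ p ^ i;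
    lamTwist p lam f i * (f (WittVector.teichmuller p (2 * lam ^ 2)⁻¹) * v 2 ^ p ^ i),
      -(f (WittVector.teichmuller p (2 * lam ^ 2)⁻¹) * v 2 ^ p ^ i)]

/-- `p (I + F)^[i]`, where `I + F` is the matrix in the basis `ω₁, …, ω₅` of the Frobenius of the
universal crystal `L_cris` over `W[[x,y,z]]`:  `F` has the blocks `E/(2p)`, `C/(2p)`, `B`, `0`.  The
factor `p` clears denominators: this is the Frobenius of `L_cris(1)`, in the basis `ω₁, …, ω₅` of
`L_cris ⊗ ℚ` (a change of lattice does not affect slopes). -/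
def frobMatrix (lam : k) (f : WittVector p k →+* R) (v : Fin 3 → R) (i : ℕ) :
    Matrix Idx Idx R :=
  Matrix.fromBlocks ((p : R) • 1 + f (half p) • matE p lam f v i) (f (half p) • matC p lam f v i)
    ((p : R) • matB p lam f v i) ((p : R) • 1)

/-- `p^N ∏_{i < N} (I + F^[i])`, the factors in increasing order from left to right. -/
def frobProd (lam : k) (f : WittVector p k →+* R) (v : Fin 3 → R) (N : ℕ) :
    Matrix Idx Idx R :=
  ((List.range N).map (frobMatrix p lam f v)).prod

end series

/-! ### Formal curves and intersection numbers -/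

/-- A formal curve `Spf k[[t]] → Spf k[[x,y,z]]`, given by the images `x(t), y(t), z(t)` of the
coordinates. -/
structure FormalCurve (k : Type*) [Field k] where
  coord : Fin 3 → k⟦X⟧
  coord_zero : ∀ i, PowerSeries.constantCoeff (coord i) = 0

/-- The intersection number of a formal curve with the divisor cut out by `g`: the `t`-adic order of
`g(x(t), y(t), z(t))`, equal to `⊤` if the curve lies on the divisor. -/
def FormalCurve.meet {k : Type*} [Field k] (c : FormalCurve k) (g : MvPowerSeries (Fin 3) k) : ℕ∞ :=
  PowerSeries.order (MvPowerSeries.subst c.coord g : k⟦X⟧)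

/-! ### Newton strata -/

section newton

variable (p : ℕ) [Fact p.Prime] {k : Type*} [Field k] [CharP k p]

instance instCharPLaurentSeries : CharP (LaurentSeries k) p :=
  charP_of_injective_algebraMap (algebraMap k (LaurentSeries k)).injective p

variable (k) in
/-- The perfect closure of `k((t))`. -/
abbrev GenericField : Type _ := PerfectClosure (LaurentSeries k) p

/-- `k[[t]] → k((t)) → k((t))^perf`. -/
def toGeneric : k⟦X⟧ →+* GenericField p k :=
  (PerfectClosure.of (LaurentSeries k) p).comp (algebraMap k⟦X⟧ (LaurentSeries k))

/-- The `n`-th iterate of the Frobenius of `L_cris(1)` at the generic point of the curve, as a matrix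
over `W(k((t))^perf)`.  The value of the `F`-crystal at this perfect field is the base change along
`x, y, z ↦ [x(t)], [y(t)], [z(t)]`, which is compatible with the Frobenius lifts. -/
def genericFrob (lam : k) (c : FormalCurve k) (n : ℕ) :
    Matrix Idx Idx (WittVector p (GenericField p k)) :=
  frobProd p lam (WittVector.map ((toGeneric p).comp (PowerSeries.C (R := k))))
    (fun i => WittVector.teichmuller p (toGeneric p (c.coord i))) n

/-- The smallest Newton slope of `L_cris` at the generic point of the curve is `s - 1`; equivalently
that of `L_cris(1)` is `s`: the `p`-adic order of the `n`-th iterate of Frobenius, divided by `n`,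
tends to `s`. -/
def HasFirstSlope (lam : k) (c : FormalCurve k) (s : ℝ≥0∞) : Prop :=
  Filter.Tendsto
    (fun n : ℕ => ((⨅ i : Idx, ⨅ j : Idx,
      emultiplicity (p : WittVector p (GenericField p k)) (genericFrob p lam c n i j) : ℕ∞) : ℝ≥0∞)
        / (n : ℝ≥0∞))
    Filter.atTop (𝓝 s)

/-- Generically ordinary: `L_cris` has slopes `-1, 0, 0, 0, 1` at the generic point.  By the
self-duality of `L_cris` the three strata are told apart by the smallest slope. -/
def GenericallyOrdinary (lam : k) (c : FormalCurve k) : Prop := HasFirstSlope p lam c 0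

/-- Generically almost ordinary: `L_cris` has slopes `-1/2, -1/2, 0, 1/2, 1/2`. -/
def GenericallyAlmostOrdinary (lam : k) (c : FormalCurve k) : Prop := HasFirstSlope p lam c (1 / 2)

/-- Generically supersingular: `L_cris` has slopes `0, 0, 0, 0, 0`. -/
def GenericallySupersingular (lam : k) (c : FormalCurve k) : Prop := HasFirstSlope p lam c 1

end newton

/-! ### Admissible index systems -/

/-- In an admissible pair `(I, J)` every maximal run of `I` has even size and so splits into pairs of
consecutive elements.  An admissible pair is thus a list of blocks in increasing order: a block
`single j` is an element of `J`, a block `pair i j` consists of the elements number `2s-1` and `2s`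
of `I`. -/
inductive Block where
  | single (j : ℕ)
  | pair (i j : ℕ)

/-- The smallest element of a block. -/
def Block.first : Block → ℕ
  | .single j => j
  | .pair i _ => i

/-- The largest element of a block. -/
def Block.last : Block → ℕ
  | .single j => j
  | .pair _ j => j

/-- The two elements of a pair are in increasing order. -/
def Block.Valid : Block → Prop
  | .single _ => True
  | .pair i j => i < j

/-- Admissibility: the indices increase, and the last index of each block and the first index of the
next one have different parities (no parity condition inside a pair). -/
def Admissible (l : List Block) : Prop :=
  (∀ b ∈ l, b.Valid) ∧ l.IsChain (fun b b' => b.last < b'.first ∧ Odd (b.last + b'.first))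

/-- The smallest index of the (nonempty) system is even. -/
def MinEven (l : List Block) : Prop := ∃ b ∈ l.head?, Even b.first

section loci

variable (p : ℕ) [Fact p.Prime] {k : Type*} [Field k] [CharP k p]

/-- `W → W[[x,y,z]]`. -/
def cst : WittVector p k →+* MvPowerSeries (Fin 3) (WittVector p k) := MvPowerSeries.C

/-- The coordinates `x, y, z` of `W[[x,y,z]]`. -/
def xyz : Fin 3 → MvPowerSeries (Fin 3) (WittVector p k) := fun i => MvPowerSeries.X i

/-- `E^[j]` for an element of `J`, and `C^[i] B^[j]` for a pair of elements of `I`. -/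
def Block.mat (lam : k) : Block →
    Matrix (Fin 2) (Fin 2) (MvPowerSeries (Fin 3) (WittVector p k))
  | .single j => matE p lam (cst p) (xyz p) j
  | .pair i j => matC p lam (cst p) (xyz p) i * matB p lam (cst p) (xyz p) j

/-- The product `A^(I,J)` of the matrices of the blocks, in increasing order. -/
def matA (lam : k) (l : List Block) :
    Matrix (Fin 2) (Fin 2) (MvPowerSeries (Fin 3) (WittVector p k)) :=
  (l.map (Block.mat p lam)).prod

/-- `X_{N,even}`, the sum of `A^(I,J)` over the admissible `(I,J)` of length `N` with even minimum.
Each coefficient receives finitely many nonzero contributions. -/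
def matXEven (lam : k) (N : ℕ) :
    Matrix (Fin 2) (Fin 2) (MvPowerSeries (Fin 3) (WittVector p k)) :=
  fun a b m => ∑ᶠ l ∈ {l : List Block | Admissible l ∧ l.length = N ∧ MinEven l},
    MvPowerSeries.coeff m (matA p lam l a b)

/-- `Y_{N,even}`, the sum of `A^(I,J) C^[j]` over the admissible `(I,J,j)` of length `N` with even
minimum.  The triple `(I,J,j)` is admissible if and only if the list of blocks of `(I,J)`, followed
by `j`, is an admissible list of blocks, and its length counts `j` as `1`. -/
def matYEven (lam : k) (N : ℕ) :
    Matrix (Fin 2) (Fin 3) (MvPowerSeries (Fin 3) (WittVector p k)) :=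
  fun a b m => ∑ᶠ q ∈ {q : List Block × ℕ | Admissible (q.1 ++ [Block.single q.2]) ∧
      (q.1 ++ [Block.single q.2]).length = N ∧ MinEven (q.1 ++ [Block.single q.2])},
    MvPowerSeries.coeff m ((matA p lam q.1 * matC p lam (cst p) (xyz p) q.2) a b)

/-- The `n`-th digit in the expansion `a = ∑ₙ [aₙ] pⁿ` of a `p`-adic integer in Teichmüller
representatives.  (Over `𝔽_p` the `n`-th Witt component is the `n`-th Teichmüller digit.) -/
def teichDigit (a : ℤ_[p]) (n : ℕ) : ZMod p := ((WittVector.equiv p).symm a).coeff n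

/-- The Teichmüller lift of the `n`-th digit, in `W`. -/
def teichDigitLift (a : ℤ_[p]) (n : ℕ) : WittVector p k :=
  WittVector.teichmuller p (ZMod.castHom (dvd_refl p) k (teichDigit p a n))

/-- The series `G¹_{n,even}(ω)` of `W[[x,y,z]]` for `ω = ∑ a_j ω_j`, `n ≥ 1`: the first entry of
`∑_{κ ≥ 0} F_{n+κ,even} (a_{1,κ}, …, a_{5,κ})ᵀ`, where the first two rows of `F_{N,even}` are
`2^(-N) [X_{N,even}, Y_{N,even}]` and `a_{j,κ}` are the Teichmüller digits of `a_j`.  Each coefficient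
receives finitely many nonzero contributions. -/
def seriesG (lam : k) (n : ℕ) (ω : Idx → ℤ_[p]) : MvPowerSeries (Fin 3) (WittVector p k) :=
  fun m => ∑ᶠ κ : ℕ, half p ^ (n + κ) *
    (∑ j : Fin 2, MvPowerSeries.coeff m (matXEven p lam (n + κ) 0 j)
        * teichDigitLift p (ω (Sum.inl j)) κ
      + ∑ j : Fin 3, MvPowerSeries.coeff m (matYEven p lam (n + κ) 0 j)
        * teichDigitLift p (ω (Sum.inr j)) κ)

/-- Reduction modulo `p`, `W[[x,y,z]] → k[[x,y,z]]`. -/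
def modP : MvPowerSeries (Fin 3) (WittVector p k) →+* MvPowerSeries (Fin 3) k :=
  MvPowerSeries.map WittVector.constantCoeff

/-- The equation `G¹_{n,even}(ω) mod p` of the formal Cartier divisor `D_n(ω)`. -/
def locusEq (lam : k) (n : ℕ) (ω : Idx → ℤ_[p]) : MvPowerSeries (Fin 3) k :=
  modP p (seriesG p lam n ω)

/-- The intersection number of the curve with `D_n(ω)`. -/
def meetLocus (lam : k) (c : FormalCurve k) (n : ℕ) (ω : Idx → ℤ_[p]) : ℕ∞ :=
  c.meet (locusEq p lam n ω)

/-- `A`, the intersection number of the curve with `α_{0,1}`. -/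
def numA (lam : k) (c : FormalCurve k) : ℕ∞ :=
  c.meet (modP p (alpha p lam (cst p) (xyz p) 0 1))

/-- `B`, the intersection number of the curve with `β_0`. -/
def numB (lam : k) (c : FormalCurve k) : ℕ∞ :=
  c.meet (modP p (beta p lam (cst p) (xyz p) 0))

/-- `d = deg(ω)`, the intersection number of the curve with `D_1(ω)`. -/
def numd (lam : k) (c : FormalCurve k) (ω : Idx → ℤ_[p]) : ℕ∞ := meetLocus p lam c 1 ω

/-- `H_e = A (1 + p^(2e-1)) + p^(2e-1) (p² - 1) deg(ω)`; the exponent is an integer, as it is `-1` for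
`e = 0`. -/
def numH (lam : k) (c : FormalCurve k) (ω : Idx → ℤ_[p]) (e : ℕ) : ℝ≥0∞ :=
  (numA p lam c : ℝ≥0∞) * (1 + (p : ℝ≥0∞) ^ (2 * (e : ℤ) - 1))
    + (p : ℝ≥0∞) ^ (2 * (e : ℤ) - 1) * ((p : ℝ≥0∞) ^ 2 - 1) * (numd p lam c ω : ℝ≥0∞)

end loci

/-! ### Deformation of special endomorphisms along a curve -/

section lifting

variable (p : ℕ) [Fact p.Prime] {k : Type*} [Field k] [CharP k p]

/-- `K = W[1/p]`, the fraction field of `W`. -/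
abbrev FracW (k : Type*) [Field k] [CharP k p] : Type _ := FractionRing (WittVector p k)

/-- Membership of `f ∈ K[[t]]` in the `p`-adically completed divided power envelope of the ideal
`(p, t^N)` of `W[[t]]`, `N ≥ 1`: `f = ∑_κ g_κ t^(Nκ) / κ!` with `g_κ ∈ W[[t]]` tending to `0`
`p`-adically. -/
def InPDEnvelope (N : ℕ) (f : (FracW p k)⟦X⟧) : Prop :=
  ∃ g : ℕ → (WittVector p k)⟦X⟧,
    (∀ r : ℕ, ∃ κ₀ : ℕ, ∀ κ, κ₀ ≤ κ → ∀ m, (p : WittVector p k) ^ r ∣ PowerSeries.coeff m (g κ)) ∧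
    ∀ m : ℕ, PowerSeries.coeff m f = ∑ κ ∈ Finset.range (m + 1),
      algebraMap (WittVector p k) (FracW p k) (PowerSeries.coeff m (PowerSeries.X ^ (N * κ) * g κ))
        / (κ.factorial : FracW p k)

/-- `ℤ_p → W`. -/
def zpToW : ℤ_[p] →+* WittVector p k :=
  (WittVector.map (ZMod.castHom (dvd_refl p) k)).comp (WittVector.equiv p).symm.toRingHom

/-- The coordinates in the basis `ω₁, …, ω₅` of the pullback to `K[[t]]` of the horizontal section
`∏_{i ≥ 0} (I + F^[i]) ω` extending `ω`, along `v = (x(t), y(t), z(t)) ∈ W[[t]]³` with zero constant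
terms.  The factors with `i > m` do not affect the coefficient of `t^m`. -/
def horizontalSection (lam : k) (v : Fin 3 → (WittVector p k)⟦X⟧) (ω : Idx → ℤ_[p]) (s : Idx) :
    (FracW p k)⟦X⟧ :=
  PowerSeries.mk fun m =>
    algebraMap (WittVector p k) (FracW p k)
      (PowerSeries.coeff m
        ((frobProd p lam (PowerSeries.C (R := WittVector p k)) v (m + 1)).mulVec
          (fun j => PowerSeries.C (zpToW p (ω j))) s))
      / (p : FracW p k) ^ (m + 1)

/-- The special endomorphism `ω` lifts to `Spf k[[t]]/(t^N)` along the curve: the pullback of its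
horizontal extension, along a lift of the curve to `W[[t]]`, is a section of
`L_cris(W) ⊗ (completed divided power envelope of (p, t^N))`.  The lattice `L_cris(W)` has the basis
`v₁, …, v₅` with `ω₁ = λ (p v₁ - v₃)`, `ω₂ = p v₁ + v₃`, `ω₃ = v₂`, `ω₄ = v₄`, `ω₅ = v₅`, so
the coordinates `s` in the basis `ω` give the coordinates `p (λ s₁ + s₂)`, `s₂ - λ s₁`, `s₃`, `s₄`,
`s₅`. -/
def LiftsTo (lam : k) (c : FormalCurve k) (ω : Idx → ℤ_[p]) (N : ℕ) : Prop :=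
  ∀ v : Fin 3 → (WittVector p k)⟦X⟧,
    (∀ i, PowerSeries.constantCoeff (v i) = 0) →
    (∀ i, PowerSeries.map WittVector.constantCoeff (v i) = c.coord i) →
    let s := horizontalSection p lam v ω
    let L : (FracW p k)⟦X⟧ := PowerSeries.C
      (algebraMap (WittVector p k) (FracW p k) (WittVector.teichmuller p lam))
    InPDEnvelope p N ((p : (FracW p k)⟦X⟧) * (L * s (Sum.inl 0) + s (Sum.inl 1))) ∧
      InPDEnvelope p N (s (Sum.inl 1) - L * s (Sum.inl 0)) ∧
      ∀ j : Fin 3, InPDEnvelope p N (s (Sum.inr j))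

/-- `ω` never decays along the curve: it lifts to `Spf k[[t]]/(t^N)` for every `N`. -/
def NeverDecays (lam : k) (c : FormalCurve k) (ω : Idx → ℤ_[p]) : Prop :=
  ∀ N : ℕ, 1 ≤ N → LiftsTo p lam c ω N

end lifting

end

end SuperspecialDecay

open SuperspecialDecay

set_option linter.unusedSectionVars false

namespace SuperspecialDecay

noncomputable section

/-! ### Teichmüller lifts and constants -/

section constants

variable {p : ℕ} [Fact p.Prime] {k : Type*} [Field k] [CharP k p]

/-! Everything rests on a recursion for the equations of the loci along the curve. As `ε` is a
nonsquare, `λ ^ p = -λ`. Each block of an admissible system is a scalar (`β_j`, or `α_{i,j}` times a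
unit constant) times a rank one matrix `u_i w_jᵀ`; the column `u_i` depends only on the parity of
`i`, and `w_i · u_{i+1} = 2`. Admissibility makes each junction of two blocks contribute this `2`,
which the factor `2^(-N)` absorbs (`truncCol_eq`, `truncSum_succ`). Modulo `p`, raising all indices
by one is raising to the `p`-th power (`truncSum_add`). Hence, if `G_n` denotes the equation of
`D_n(ω)` along the curve, `G_{n+1}` is the sum over blocks `b` with even first index of `weight b *
G_n ^ p ^ (b.last + 1)` (`exists_X_pow_dvd_locusOn_sub_sum`).

Put `V_n = ord G_n`. The blocks `{0}` and `(0,1)` give terms of order `B + p V_n` and `A + p² V_n`.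
All others have order strictly above the smaller of the two
(`min_order_add_one_le_order_weight_mul`), because a vector isotropic and orthogonal to its first
Frobenius twist modulo an ideal is orthogonal to all its twists modulo that ideal (`form_mem`). So
`V_{n+1}` is at least the minimum of the two orders, with equality when they differ. For `B = ⊤`
this yields the almost ordinary formula (`order_eq_of_top`); for finite values, `A + p² V` is the
smaller term until `V` passes a threshold, and `B + p V` afterwards (`order_cases`). A tie can occur
only on reaching step `e`, hence the undetermined `D`.

The Newton slopes enter through the vanishing of `β_0` and `α_{0,1}` on the curve. If `β_0 ≠ 0`, the
iterates of Frobenius on `L_cris(1)` are nonzero modulo `p`, so the slope is `0`. If `β_0 = 0` and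
`α_{0,1} ≠ 0`, the product of `2n` factors has an entry of order exactly `n`, so the slope is at
most `1/2`. On a supersingular curve both therefore vanish, hence so do all weights and all `G_n`
with `n ≥ 2`; moreover the horizontal section through `p ω` has coefficients in `W`
(`neverDecays_of_eq_zero`). -/

theorem two_ne_zero_of_odd (hp : p ≠ 2) : (2 : k) ≠ 0 := by
  have : ((2 : ℕ) : k) ≠ 0 := by
    rw [Ne, CharP.cast_eq_zero_iff k p]
    intro h
    exact hp ((Nat.prime_dvd_prime_iff_eq Fact.out Nat.prime_two).1 h)
  exact_mod_cast this

theorem odd_pow_char (hp : p ≠ 2) (i : ℕ) : Odd (p ^ i) :=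
  ((Fact.out : p.Prime).odd_of_ne_two hp).pow

/-- The lift of `-1` squares to `1` in a domain and does not reduce to `1`, so it is `-1`. This
turns `λ ^ p = -λ` into a sign rule for the twists, and later forces `β` to vanish exactly in Witt
vectors. -/
theorem teichmuller_neg (hp : p ≠ 2) (a : k) :
    WittVector.teichmuller p (-a) = -WittVector.teichmuller p a := by
  have h1 : WittVector.teichmuller p (-1 : k) = -1 := by
    have h2 : WittVector.teichmuller p (-1 : k) * WittVector.teichmuller p (-1 : k) = 1 := by
      rw [← map_mul]; simp
    rcases mul_self_eq_one_iff.1 h2 with h | h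
    · exfalso
      have h3 := congrArg WittVector.constantCoeff h
      have h4 : WittVector.constantCoeff (WittVector.teichmuller p (-1 : k)) = -1 :=
        WittVector.teichmuller_coeff_zero p _
      rw [h4, map_one] at h3
      apply two_ne_zero_of_odd (k := k) hp
      linear_combination (-1 : k) * h3
    · exact h
  rw [neg_eq_neg_one_mul, map_mul, h1, neg_one_mul]

theorem half_mul_two [PerfectRing k p] (hp : p ≠ 2) : (half p : WittVector p k) * 2 = 1 := by
  apply Ring.inverse_mul_cancel
  apply WittVector.isUnit_of_coeff_zero_ne_zero
  have : WittVector.constantCoeff (2 : WittVector p k) = 2 := map_ofNat _ 2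
  exact fun h => two_ne_zero_of_odd (k := k) hp (this.symm.trans h)

theorem dvd_iff_constantCoeff [PerfectRing k p] (x : WittVector p k) :
    (p : WittVector p k) ∣ x ↔ WittVector.constantCoeff x = 0 := by
  rw [← Ideal.mem_span_singleton, WittVector.mem_span_p_iff_coeff_zero_eq_zero]
  rfl

/-- A square root of a nonsquare of the prime field is anti-invariant under Frobenius. -/
theorem pow_char_eq_neg (hp : p ≠ 2) {eps : ZMod p} (heps : ¬ IsSquare eps) {lam : k}
    (hlam : lam ^ 2 = ZMod.castHom (dvd_refl p) k eps) : lam ^ p = -lam := by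
  have h0 : eps ≠ 0 := by rintro rfl; exact heps ⟨0, by simp⟩
  have h1 : eps ^ (p / 2) = -1 := by
    rcases ZMod.pow_div_two_eq_neg_one_or_one p h0 with h | h
    · exact absurd ((ZMod.euler_criterion p h0).2 h) heps
    · exact h
  have h2 : p = 2 * (p / 2) + 1 := by
    have := (Fact.out : p.Prime).odd_of_ne_two hp
    have := Nat.two_mul_div_two_add_one_of_odd this
    omega
  calc lam ^ p = lam ^ (2 * (p / 2) + 1) := by rw [← h2]
    _ = (lam ^ 2) ^ (p / 2) * lam := by rw [pow_succ, pow_mul]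
    _ = -lam := by rw [hlam, ← map_pow, h1]; simp

theorem ne_zero_of_sq_eq {eps : ZMod p} (heps : ¬ IsSquare eps) {lam : k}
    (hlam : lam ^ 2 = ZMod.castHom (dvd_refl p) k eps) : lam ≠ 0 := by
  rintro rfl
  have : ZMod.castHom (dvd_refl p) k eps = ZMod.castHom (dvd_refl p) k 0 := by
    rw [← hlam]; simp
  have := (ZMod.castHom (dvd_refl p) k).injective this
  exact heps ⟨0, by simp [this]⟩

theorem pow_char_pow_succ (hp : p ≠ 2) {lam : k} (h : lam ^ p = -lam) (i : ℕ) :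
    lam ^ p ^ (i + 1) = -lam ^ p ^ i := by
  rw [pow_succ', pow_mul, h, (odd_pow_char hp i).neg_pow]

/-- These constants lie in the prime field, so twisting `α` and `β` by Frobenius leaves them alone.
-/
theorem inv_natCast_mul_sq_pow_char {lam : k} (h : lam ^ p = -lam) (n : ℕ) :
    ((n * lam ^ 2)⁻¹ : k) ^ p = (n * lam ^ 2)⁻¹ := by
  have h1 : (n : k) ^ p = n := by
    rw [← frobenius_def, map_natCast]
  rw [inv_pow, mul_pow, ← pow_mul, mul_comm 2 p, pow_mul, h, neg_sq, h1]

end constants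

/-! ### The rank one structure of the blocks -/

section blocks

variable (p : ℕ) [Fact p.Prime] {k : Type*} [Field k] [CharP k p] {R S : Type*} [CommRing R]
  [CommRing S]

/-- The column `(1, λ^[i])`. -/
def colU (lam : k) (f : WittVector p k →+* R) (i : ℕ) : Fin 2 → R := ![1, lamTwist p lam f i]

/-- The row `(1, -(1/λ)^[i])`. -/
def rowW (lam : k) (f : WittVector p k →+* R) (i : ℕ) : Fin 2 → R := ![1, -lamInvTwist p lam f i]

/-- The coordinates `(x^[i], y^[i], z^[i])`. -/
def rowV (v : Fin 3 → R) (i : ℕ) : Fin 3 → R := fun a => v a ^ p ^ i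

/-- The vector `(y^[i], x^[i], z^[i] / (2ε))`. -/
def dualV (lam : k) (f : WittVector p k →+* R) (v : Fin 3 → R) (i : ℕ) : Fin 3 → R :=
  ![v 1 ^ p ^ i, v 0 ^ p ^ i, f (WittVector.teichmuller p (2 * lam ^ 2)⁻¹) * v 2 ^ p ^ i]

variable {p} {lam : k} (f : WittVector p k →+* R) (v : Fin 3 → R)

theorem lamInvTwist_mul_lamTwist (h : lam ≠ 0) (i : ℕ) :
    lamInvTwist p lam f i * lamTwist p lam f i = 1 := by
  rw [lamInvTwist, lamTwist, ← map_mul, ← map_mul, ← mul_pow, inv_mul_cancel₀ h, one_pow, map_one,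
    map_one]

theorem lamTwist_succ (hp : p ≠ 2) (h : lam ^ p = -lam) (i : ℕ) :
    lamTwist p lam f (i + 1) = -lamTwist p lam f i := by
  rw [lamTwist, lamTwist, pow_char_pow_succ hp h, teichmuller_neg hp, map_neg]

theorem lamTwist_add_two_mul (hp : p ≠ 2) (h : lam ^ p = -lam) (i n : ℕ) :
    lamTwist p lam f (i + 2 * n) = lamTwist p lam f i := by
  induction n with
  | zero => rfl
  | succ n ih =>
    rw [mul_add, ← add_assoc, mul_one, ← one_add_one_eq_two, ← add_assoc, lamTwist_succ f hp h,
      lamTwist_succ f hp h, neg_neg, one_add_one_eq_two, ih]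

/-- The parity condition on first indices thus makes all systems in one sum share the same column.
-/
theorem colU_eq_of_even (hp : p ≠ 2) (h : lam ^ p = -lam) {i j : ℕ} (hij : Even (i + j)) :
    colU p lam f i = colU p lam f j := by
  wlog hle : i ≤ j generalizing i j
  · exact (this (by rwa [add_comm]) (le_of_not_ge hle)).symm
  obtain ⟨d, rfl⟩ := Nat.exists_eq_add_of_le hle
  obtain ⟨n, rfl⟩ : Even d := by
    rw [← add_assoc] at hij
    rcases Nat.even_add.1 hij with h'
    exact h'.1 ⟨i, rfl⟩
  rw [colU, colU, ← two_mul, lamTwist_add_two_mul f hp h]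

/-- The sign change of `λ` between neighbouring parities makes the two terms add up; for equal
parities they would cancel. This is the source of the powers of `2`. -/
theorem rowW_dotProduct_colU (hp : p ≠ 2) (h0 : lam ≠ 0) (h : lam ^ p = -lam) (i : ℕ) :
    rowW p lam f i ⬝ᵥ colU p lam f (i + 1) = 2 := by
  have := lamInvTwist_mul_lamTwist f h0 i
  rw [colU, lamTwist_succ f hp h]
  simp only [rowW, dotProduct, Fin.sum_univ_two, Matrix.cons_val_zero, Matrix.cons_val_one]
  linear_combination this

theorem matE_eq (h0 : lam ≠ 0) (i : ℕ) :
    matE p lam f v i = beta p lam f v i • Matrix.vecMulVec (colU p lam f i) (rowW p lam f i) := by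
  have := lamInvTwist_mul_lamTwist f h0 i
  rw [matE]
  congr 1
  ext a b
  fin_cases a <;> fin_cases b <;> simp [Matrix.vecMulVec, colU, rowW]
  linear_combination -this

theorem matC_eq (h0 : lam ≠ 0) (i : ℕ) :
    matC p lam f v i = lamInvTwist p lam f i • Matrix.vecMulVec (colU p lam f i) (rowV p v i) := by
  have := lamInvTwist_mul_lamTwist f h0 i
  ext a b
  fin_cases a <;> fin_cases b <;> simp [matC, Matrix.vecMulVec, colU, rowV] <;>
    rw [← mul_assoc, this, one_mul]

theorem matB_eq (h0 : lam ≠ 0) (i : ℕ) :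
    matB p lam f v i =
      lamTwist p lam f i • Matrix.vecMulVec (dualV p lam f v i) (rowW p lam f i) := by
  have := lamInvTwist_mul_lamTwist f h0 i
  ext a b
  fin_cases a <;> fin_cases b <;> simp [matB, Matrix.vecMulVec, dualV, rowW, -mul_inv_rev]
  · linear_combination -v 1 ^ p ^ i * this
  · linear_combination -v 0 ^ p ^ i * this
  · linear_combination -(f (WittVector.teichmuller p (2 * lam ^ 2)⁻¹) * v 2 ^ p ^ i) * this

theorem rowV_dotProduct_dualV (i j : ℕ) :
    rowV p v i ⬝ᵥ dualV p lam f v j = alpha p lam f v i j := by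
  simp only [rowV, dotProduct, dualV, alpha, Fin.sum_univ_three, Matrix.cons_val_zero,
    Matrix.cons_val_one, Matrix.cons_val]
  ring

theorem matC_mul_matB (h0 : lam ≠ 0) (i j : ℕ) :
    matC p lam f v i * matB p lam f v j =
      (lamInvTwist p lam f i * lamTwist p lam f j * alpha p lam f v i j) •
        Matrix.vecMulVec (colU p lam f i) (rowW p lam f j) := by
  rw [matC_eq f v h0, matB_eq f v h0, Matrix.smul_mul, Matrix.mul_smul,
    Matrix.vecMulVec_mul_vecMulVec, rowV_dotProduct_dualV, smul_smul, Matrix.vecMulVec_smul,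
    smul_smul]

/-! ### Base change -/

variable (φ : R →+* S)

theorem map_alpha (i j : ℕ) :
    φ (alpha p lam f v i j) = alpha p lam (φ.comp f) (fun a => φ (v a)) i j := by
  simp [alpha]

theorem map_beta (i : ℕ) :
    φ (beta p lam f v i) = beta p lam (φ.comp f) (fun a => φ (v a)) i := by
  simp [beta]

theorem map_matE (i : ℕ) :
    (matE p lam f v i).map φ = matE p lam (φ.comp f) (fun a => φ (v a)) i := by
  ext a b
  fin_cases a <;> fin_cases b <;>
    simp [matE, map_beta, lamTwist, lamInvTwist]

theorem map_matC (i : ℕ) :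
    (matC p lam f v i).map φ = matC p lam (φ.comp f) (fun a => φ (v a)) i := by
  ext a b
  fin_cases a <;> fin_cases b <;> simp [matC, lamInvTwist]

theorem map_matB (i : ℕ) :
    (matB p lam f v i).map φ = matB p lam (φ.comp f) (fun a => φ (v a)) i := by
  ext a b
  fin_cases a <;> fin_cases b <;> simp [matB, lamTwist]

end blocks

/-! ### Enumeration of bounded admissible systems -/

open Classical in
/-- The blocks with indices below `M` whose first index is at least `m` and has the parity
of `m`. -/
def blocks (M m : ℕ) : Finset Block :=
  (((Finset.range M).image Block.single) ∪
    ((Finset.range M ×ˢ Finset.range M).image fun q => Block.pair q.1 q.2)).filter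
      fun b => b.Valid ∧ m ≤ b.first ∧ Even (m + b.first)

theorem Block.first_le_last {b : Block} (h : b.Valid) : b.first ≤ b.last := by
  cases b with
  | single j => exact le_rfl
  | pair i j => exact Nat.le_of_lt h

theorem mem_blocks {M m : ℕ} {b : Block} :
    b ∈ blocks M m ↔ b.Valid ∧ m ≤ b.first ∧ Even (m + b.first) ∧ b.last < M := by
  cases b with
  | single j => simp [blocks, Block.last]; tauto
  | pair i j =>
    simp only [blocks, Finset.mem_filter, Finset.mem_union, Finset.mem_image, Finset.mem_range,
      reduceCtorEq, and_false, exists_false, Finset.mem_product, Block.pair.injEq, Prod.exists,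
      exists_eq_right_right, exists_eq_right, false_or, Block.last]
    constructor
    · tauto
    · rintro ⟨h1, h2, h3, h4⟩
      exact ⟨⟨lt_trans h1 h4, h4⟩, h1, h2, h3⟩

/-- The single blocks of `blocks M m`, given by their index. -/
def singles (M m : ℕ) : Finset ℕ := (Finset.range M).filter fun j => m ≤ j ∧ Even (m + j)

theorem mem_singles {M m j : ℕ} : j ∈ singles M m ↔ Block.single j ∈ blocks M m := by
  simp [singles, mem_blocks, Block.Valid, Block.first, Block.last]
  tauto

/-- Admissibility of a list of blocks that is to follow an index `m - 1`. -/
def AdmissibleFrom : ℕ → List Block → Prop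
  | _, [] => True
  | m, b :: l => (b.Valid ∧ m ≤ b.first ∧ Even (m + b.first)) ∧ AdmissibleFrom (b.last + 1) l

theorem admissibleFrom_cons_iff (m : ℕ) (b : Block) (l : List Block) :
    AdmissibleFrom m (b :: l) ↔ (m ≤ b.first ∧ Even (m + b.first)) ∧ Admissible (b :: l) := by
  induction l generalizing m b with
  | nil => simp [AdmissibleFrom, Admissible]; tauto
  | cons b' l ih =>
    rw [AdmissibleFrom, ih]
    simp only [Admissible, List.mem_cons, forall_eq_or_imp, List.isChain_cons_cons,
      Nat.succ_le_iff]
    have : Even (b.last + 1 + b'.first) ↔ Odd (b.last + b'.first) := by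
      rw [add_right_comm, Nat.even_add_one, Nat.not_even_iff_odd]
    rw [this]
    tauto

/-- A virtual previous index `-1` encodes the even minimum, so the condition on the smallest index
becomes an instance of the condition between blocks. -/
theorem admissible_and_minEven_iff (l : List Block) :
    Admissible l ∧ MinEven l ↔ l ≠ [] ∧ AdmissibleFrom 0 l := by
  cases l with
  | nil => simp [MinEven]
  | cons b l => simp [admissibleFrom_cons_iff, MinEven, and_comm]

/-- Each block raises the last index by at least one. Bounded indices therefore bound the length,
which makes the sum over digits finite after truncation. -/
theorem AdmissibleFrom.le_last {m : ℕ} {l : List Block} {b : Block}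
    (h : AdmissibleFrom m (l ++ [b])) : m + l.length ≤ b.last := by
  induction l generalizing m with
  | nil => simpa using h.1.2.1.trans (Block.first_le_last h.1.1)
  | cons b' l ih =>
    have h1 := ih h.2
    have h2 := h.1.2.1.trans (Block.first_le_last h.1.1)
    simp only [List.length_cons]
    omega

open Classical in
/-- The admissible systems of length `N` that may follow an index `m - 1`, with indices
below `M`. -/
def systems (M : ℕ) : ℕ → ℕ → Finset (List Block)
  | 0, _ => {[]}
  | N + 1, m => (blocks M m).biUnion fun b => (systems M N (b.last + 1)).image (b :: ·)

theorem mem_systems {M N m : ℕ} {l : List Block} :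
    l ∈ systems M N m ↔ AdmissibleFrom m l ∧ l.length = N ∧ ∀ b ∈ l, b.last < M := by
  induction N generalizing m l with
  | zero => cases l <;> simp [systems, AdmissibleFrom]
  | succ N ih =>
    cases l with
    | nil => simp [systems]
    | cons b l =>
      simp only [systems, Finset.mem_biUnion, Finset.mem_image, ih, mem_blocks, List.cons.injEq,
        AdmissibleFrom, List.length_cons, List.mem_cons, forall_eq_or_imp, Nat.add_right_cancel_iff]
      constructor
      · rintro ⟨b', h1, l', h2, rfl, rfl⟩
        tauto
      · intro h
        exact ⟨b, by tauto, l, by tauto, rfl, rfl⟩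

theorem sum_systems_succ {A : Type*} [AddCommMonoid A] (M N m : ℕ) (F : List Block → A) :
    ∑ l ∈ systems M (N + 1) m, F l =
      ∑ b ∈ blocks M m, ∑ l ∈ systems M N (b.last + 1), F (b :: l) := by
  classical
  rw [systems, Finset.sum_biUnion]
  · refine Finset.sum_congr rfl fun b _ => ?_
    rw [Finset.sum_image]
    intro l _ l' _ h
    exact (List.cons.inj h).2
  · intro b _ b' _ hne
    rw [Function.onFun, Finset.disjoint_left]
    intro l hl hl'
    obtain ⟨l1, _, rfl⟩ := Finset.mem_image.1 hl
    obtain ⟨l2, _, h⟩ := Finset.mem_image.1 hl'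
    exact hne (List.cons.inj h).1.symm

open Classical in
/-- The admissible systems of length `N` with a final single block set apart. -/
def markedSystems (M : ℕ) : ℕ → ℕ → Finset (List Block × ℕ)
  -- The marked final block counts in the length, so length zero is impossible.
  | 0, _ => ∅
  | 1, m => (singles M m).image fun j => ([], j)
  | N + 2, m => (blocks M m).biUnion fun b =>
      (markedSystems M (N + 1) (b.last + 1)).image fun q => (b :: q.1, q.2)

theorem mem_markedSystems {M N m : ℕ} {q : List Block × ℕ} :
    q ∈ markedSystems M (N + 1) m ↔ AdmissibleFrom m (q.1 ++ [Block.single q.2]) ∧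
      (q.1 ++ [Block.single q.2]).length = N + 1 ∧
      ∀ b ∈ q.1 ++ [Block.single q.2], b.last < M := by
  obtain ⟨l, j⟩ := q
  induction N generalizing m l with
  | zero =>
    cases l with
    | nil => simp [markedSystems, AdmissibleFrom, mem_singles, mem_blocks]; tauto
    | cons b l => simp [markedSystems]
  | succ N ih =>
    cases l with
    | nil => simp [markedSystems]
    | cons b l =>
      simp only [markedSystems, Finset.mem_biUnion, Finset.mem_image, Prod.mk.injEq, Prod.exists,
        mem_blocks, AdmissibleFrom, List.length_cons, List.mem_cons, List.cons_append,
        List.cons.injEq, forall_eq_or_imp, Nat.add_right_cancel_iff]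
      constructor
      · rintro ⟨b', h1, l', j', h2, ⟨rfl, rfl⟩, rfl⟩
        have h3 := (ih _).1 h2
        tauto
      · intro h
        exact ⟨b, by tauto, l, j, (ih _).2 (by tauto), ⟨rfl, rfl⟩, rfl⟩

theorem sum_markedSystems_one {A : Type*} [AddCommMonoid A] (M m : ℕ)
    (F : List Block × ℕ → A) :
    ∑ q ∈ markedSystems M 1 m, F q = ∑ j ∈ singles M m, F ([], j) := by
  classical
  rw [markedSystems, Finset.sum_image]
  intro j _ j' _ h
  exact (Prod.mk.inj h).2

theorem sum_markedSystems_succ {A : Type*} [AddCommMonoid A] (M N m : ℕ)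
    (F : List Block × ℕ → A) :
    ∑ q ∈ markedSystems M (N + 2) m, F q =
      ∑ b ∈ blocks M m, ∑ q ∈ markedSystems M (N + 1) (b.last + 1), F (b :: q.1, q.2) := by
  classical
  rw [markedSystems, Finset.sum_biUnion]
  · refine Finset.sum_congr rfl fun b _ => ?_
    rw [Finset.sum_image]
    rintro ⟨l, j⟩ _ ⟨l', j'⟩ _ h
    simpa using h
  · intro b _ b' _ hne
    rw [Function.onFun, Finset.disjoint_left]
    intro l hl hl'
    obtain ⟨l1, _, rfl⟩ := Finset.mem_image.1 hl
    obtain ⟨l2, _, h⟩ := Finset.mem_image.1 hl'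
    exact hne (List.cons.inj (Prod.mk.inj h).1).1.symm

/-- All indices of a block increased by one. -/
def Block.shift : Block → Block
  | .single j => .single (j + 1)
  | .pair i j => .pair (i + 1) (j + 1)

theorem Block.shift_last (b : Block) : b.shift.last = b.last + 1 := by cases b <;> rfl

/-- The combinatorial half of the Frobenius twist. The upper bound moves together with the lower
one, which is why the bound `M` has to be tracked below. -/
theorem sum_blocks_succ {A : Type*} [AddCommMonoid A] (M m : ℕ) (F : Block → A) :
    ∑ b ∈ blocks (M + 1) (m + 1), F b = ∑ b ∈ blocks M m, F b.shift := by
  symm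
  refine Finset.sum_bij (fun b _ => b.shift) ?_ ?_ ?_ fun _ _ => rfl
  · intro b hb
    rw [mem_blocks] at hb ⊢
    cases b <;> simp only [Block.shift, Block.Valid, Block.first, Block.last, Nat.even_iff, true_and] at hb ⊢ <;>
      omega
  · rintro (j | ⟨i, j⟩) _ (j' | ⟨i', j'⟩) _ h <;> simp_all [Block.shift]
  · intro b hb
    rw [mem_blocks] at hb
    rcases b with (_ | j) | ⟨_ | i, _ | j⟩ <;>
      simp only [Block.Valid, Block.first, Block.last, Nat.even_iff, true_and] at hb
    · omega
    · exact ⟨.single j, mem_blocks.2 (by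
        simp only [Block.Valid, Block.first, Block.last, Nat.even_iff, true_and]
        omega), rfl⟩
    · omega
    · omega
    · omega
    · exact ⟨.pair i j, mem_blocks.2 (by
        simp only [Block.Valid, Block.first, Block.last, Nat.even_iff]
        omega), rfl⟩

theorem sum_singles_succ {A : Type*} [AddCommMonoid A] (M m : ℕ) (F : ℕ → A) :
    ∑ j ∈ singles (M + 1) (m + 1), F j = ∑ j ∈ singles M m, F (j + 1) := by
  symm
  refine Finset.sum_bij (fun j _ => j + 1) ?_ ?_ ?_ fun _ _ => rfl
  · intro j hj
    simp only [singles, Finset.mem_filter, Finset.mem_range, Nat.even_iff] at hj ⊢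
    omega
  · intro j _ j' _ h
    omega
  · rintro (_ | j) hj
    · simp [singles] at hj
    · simp only [singles, Finset.mem_filter, Finset.mem_range, Nat.even_iff] at hj
      refine ⟨j, ?_, rfl⟩
      simp only [singles, Finset.mem_filter, Finset.mem_range, Nat.even_iff]
      omega

/-! ### Sums over bounded admissible systems -/

section transfer

variable (p : ℕ) [Fact p.Prime] {k : Type*} [Field k] [CharP k p] {R S : Type*} [CommRing R]
  [CommRing S] (lam : k) (f : WittVector p k →+* R) (v : Fin 3 → R)

/-- The matrix of a block, over any ring over the Witt vectors. -/
def blockMat : Block → Matrix (Fin 2) (Fin 2) R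
  | .single j => matE p lam f v j
  | .pair i j => matC p lam f v i * matB p lam f v j

/-- The matrix of a system, over any ring over the Witt vectors. -/
def systemMat (l : List Block) : Matrix (Fin 2) (Fin 2) R := (l.map (blockMat p lam f v)).prod

/-- The scalar by which the matrix of a block differs from its standard rank one matrix. -/
def weight : Block → R
  | .single j => beta p lam f v j
  | .pair i j => lamInvTwist p lam f i * lamTwist p lam f j * alpha p lam f v i j

/-- The contribution of a digit vector `(a, a')` to the systems of length `N`. -/
def truncCol (M N m : ℕ) (a : Fin 2 → R) (a' : Fin 3 → R) : Fin 2 → R :=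
  (∑ l ∈ systems M N m, systemMat p lam f v l).mulVec a +
    (∑ q ∈ markedSystems M N m, systemMat p lam f v q.1 * matC p lam f v q.2).mulVec a'

/-- The scalar by which `truncCol` of length `N + 1` differs from the standard column. -/
def truncScalar (M : ℕ) (a : Fin 2 → R) (a' : Fin 3 → R) : ℕ → ℕ → R
  | 0, m => ∑ b ∈ blocks M m, weight p lam f v b * (rowW p lam f b.last ⬝ᵥ a) +
      ∑ j ∈ singles M m, lamInvTwist p lam f j * (rowV p v j ⬝ᵥ a')
  | N + 1, m => ∑ b ∈ blocks M m, 2 * weight p lam f v b * truncScalar M a a' N (b.last + 1)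

variable {p lam}

theorem blockMat_eq (h0 : lam ≠ 0) (b : Block) :
    blockMat p lam f v b = weight p lam f v b •
      Matrix.vecMulVec (colU p lam f b.first) (rowW p lam f b.last) := by
  cases b with
  | single j => exact matE_eq f v h0 j
  | pair i j => exact matC_mul_matB f v h0 i j

theorem smul_vecMulVec_mulVec {n₁ n₂ : Type*} [Fintype n₂] (c : R) (u : n₁ → R) (w a : n₂ → R) :
    (c • Matrix.vecMulVec u w).mulVec a = (c * (w ⬝ᵥ a)) • u := by
  ext i
  simp only [Matrix.mulVec, Matrix.smul_apply, Matrix.vecMulVec, Matrix.of_apply, dotProduct,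
    Pi.smul_apply, smul_eq_mul, Finset.mul_sum, Finset.sum_mul]
  exact Finset.sum_congr rfl fun j _ => by ring

theorem systemMat_cons (b : Block) (l : List Block) :
    systemMat p lam f v (b :: l) = blockMat p lam f v b * systemMat p lam f v l := by
  simp [systemMat]

theorem truncCol_succ (M N m : ℕ) (a : Fin 2 → R) (a' : Fin 3 → R) :
    truncCol p lam f v M (N + 2) m a a' = ∑ b ∈ blocks M m,
      (blockMat p lam f v b).mulVec (truncCol p lam f v M (N + 1) (b.last + 1) a a') := by
  simp only [truncCol, sum_systems_succ M (N + 1), sum_markedSystems_succ, systemMat_cons,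
    Matrix.mulVec_add, ← Matrix.mulVec_mulVec, Matrix.mulVec_sum, Finset.sum_add_distrib, Matrix.sum_mulVec,
    Matrix.mul_assoc]

/-- Peel off the first block: the rest is by induction a multiple of the column at `b.last + 1`,
which the row of the block pairs to `2`. The matrix recursion becomes a scalar one. -/
theorem truncCol_eq (hp : p ≠ 2) (h0 : lam ≠ 0) (h : lam ^ p = -lam) (M N m : ℕ) (a : Fin 2 → R)
    (a' : Fin 3 → R) :
    truncCol p lam f v M (N + 1) m a a' =
      truncScalar p lam f v M a a' N m • colU p lam f m := by
  induction N generalizing m with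
  | zero =>
    rw [truncCol, truncScalar, zero_add, sum_systems_succ, sum_markedSystems_one, add_smul,
      Matrix.sum_mulVec, Matrix.sum_mulVec, Finset.sum_smul, Finset.sum_smul]
    congr 1
    · refine Finset.sum_congr rfl fun b hb => ?_
      rw [mem_blocks] at hb
      simp only [systems, Finset.sum_singleton]
      rw [systemMat_cons, systemMat, List.map_nil, List.prod_nil, mul_one, blockMat_eq f v h0,
        smul_vecMulVec_mulVec, colU_eq_of_even f hp h hb.2.2.1]
    · refine Finset.sum_congr rfl fun j hj => ?_
      rw [mem_singles, mem_blocks] at hj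
      rw [systemMat, List.map_nil, List.prod_nil, Matrix.one_mul, matC_eq f v h0,
        smul_vecMulVec_mulVec, colU_eq_of_even f hp h hj.2.2.1]
      rfl
  | succ N ih =>
    rw [truncCol_succ, truncScalar, Finset.sum_smul]
    refine Finset.sum_congr rfl fun b hb => ?_
    rw [mem_blocks] at hb
    rw [ih, blockMat_eq f v h0, smul_vecMulVec_mulVec, dotProduct_smul,
      rowW_dotProduct_colU f hp h0 h, colU_eq_of_even f hp h hb.2.2.1, smul_eq_mul]
    congr 1
    ring

theorem map_blockMat (φ : R →+* S) (b : Block) :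
    (blockMat p lam f v b).map φ = blockMat p lam (φ.comp f) (fun a => φ (v a)) b := by
  cases b with
  | single j => exact map_matE f v φ j
  | pair i j => rw [blockMat, Matrix.map_mul, map_matC, map_matB]; rfl

theorem map_systemMat (φ : R →+* S) (l : List Block) :
    (systemMat p lam f v l).map φ = systemMat p lam (φ.comp f) (fun a => φ (v a)) l := by
  induction l with
  | nil => exact Matrix.map_one φ (map_zero φ) (map_one φ)
  | cons b l ih => rw [systemMat_cons, systemMat_cons, Matrix.map_mul, ih, map_blockMat]

theorem map_truncCol (φ : R →+* S) (M N m : ℕ) (a : Fin 2 → R) (a' : Fin 3 → R) (i : Fin 2) :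
    φ (truncCol p lam f v M N m a a' i) =
      truncCol p lam (φ.comp f) (fun a => φ (v a)) M N m (φ ∘ a) (φ ∘ a') i := by
  simp only [truncCol, Pi.add_apply, map_add, RingHom.map_mulVec, Matrix.sum_mulVec, Finset.sum_apply,
    map_sum]
  congr 1
  · exact Finset.sum_congr rfl fun l _ => by rw [map_systemMat]
  · exact Finset.sum_congr rfl fun l _ => by rw [Matrix.map_mul, map_systemMat, map_matC]

/-! ### The generating sums over all lengths -/

variable (p lam) in
/-- The sum over the lengths `n + 1 + κ`, `κ < K`, with indices below `M`, for the digit vectors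
`a κ, a' κ`. -/
def truncSum (M K : ℕ) (a : ℕ → Fin 2 → R) (a' : ℕ → Fin 3 → R) (n m : ℕ) : R :=
  ∑ κ ∈ Finset.range K,
    f (half p) ^ (n + 1 + κ) * truncScalar p lam f v M (a κ) (a' κ) (n + κ) m

/-- The extra factor `1/2` of the longer system cancels the `2` of the new junction, leaving the
bare weight. -/
theorem truncSum_succ (h2 : f (half p) * 2 = 1) (M K : ℕ) (a : ℕ → Fin 2 → R)
    (a' : ℕ → Fin 3 → R) (n m : ℕ) :
    truncSum p lam f v M K a a' (n + 1) m = ∑ b ∈ blocks M m,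
      weight p lam f v b * truncSum p lam f v M K a a' n (b.last + 1) := by
  simp only [truncSum, Finset.mul_sum]
  rw [Finset.sum_comm]
  refine Finset.sum_congr rfl fun κ _ => ?_
  rw [show n + 1 + κ = n + κ + 1 by ring, truncScalar, Finset.mul_sum]
  refine Finset.sum_congr rfl fun b _ => ?_
  rw [show n + 1 + 1 + κ = n + κ + 1 + 1 by ring, pow_succ (f (half p)) (n + κ + 1)]
  linear_combination (f (half p) ^ (n + κ + 1) * weight p lam f v b *
    truncScalar p lam f v M (a κ) (a' κ) (n + κ) (b.last + 1)) * h2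

/-! ### Frobenius -/

section frobenius

variable [CharP R p]

theorem map_teichmuller_pow_char {c : k} (h : c ^ p = c) :
    f (WittVector.teichmuller p c) ^ p = f (WittVector.teichmuller p c) := by
  rw [← map_pow, ← map_pow, h]

theorem alpha_succ (h : lam ^ p = -lam) (i j : ℕ) :
    alpha p lam f v (i + 1) (j + 1) = alpha p lam f v i j ^ p := by
  have h1 := map_teichmuller_pow_char f (inv_natCast_mul_sq_pow_char h 2)
  rw [Nat.cast_ofNat] at h1
  simp only [alpha]
  generalize f (WittVector.teichmuller p (2 * lam ^ 2)⁻¹) = c at h1 ⊢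
  simp only [add_pow_char, mul_pow, h1, ← pow_mul, pow_succ]

theorem beta_succ (h : lam ^ p = -lam) (i : ℕ) :
    beta p lam f v (i + 1) = beta p lam f v i ^ p := by
  have h1 := map_teichmuller_pow_char f (inv_natCast_mul_sq_pow_char h 4)
  rw [Nat.cast_ofNat] at h1
  simp only [beta]
  generalize f (WittVector.teichmuller p (4 * lam ^ 2)⁻¹) = c at h1 ⊢
  rw [add_pow_char, mul_pow, mul_pow, h1]
  ring

theorem lamTwist_succ_eq_pow (i : ℕ) :
    lamTwist p lam f (i + 1) = lamTwist p lam f i ^ p := by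
  rw [lamTwist, lamTwist, pow_succ, pow_mul, map_pow, map_pow]

theorem lamInvTwist_succ_eq_pow (i : ℕ) :
    lamInvTwist p lam f (i + 1) = lamInvTwist p lam f i ^ p := by
  rw [lamInvTwist, lamInvTwist, pow_succ, pow_mul, map_pow, map_pow]

theorem weight_shift (h : lam ^ p = -lam) (b : Block) :
    weight p lam f v b.shift = weight p lam f v b ^ p := by
  cases b with
  | single j => exact beta_succ f v h j
  | pair i j =>
    simp only [Block.shift, weight, alpha_succ f v h, lamTwist_succ_eq_pow,
      lamInvTwist_succ_eq_pow, mul_pow]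

/-- Weights, rows and coordinates at index `i + 1` are `p`-th powers of those at `i`, and digits
over `𝔽_p` are fixed by Frobenius. -/
theorem truncScalar_shift (hp : p ≠ 2) (h : lam ^ p = -lam) {a : Fin 2 → R} {a' : Fin 3 → R}
    (ha : ∀ i, a i ^ p = a i) (ha' : ∀ i, a' i ^ p = a' i) (M N m : ℕ) :
    truncScalar p lam f v (M + 1) a a' N (m + 1) = truncScalar p lam f v M a a' N m ^ p := by
  have hodd : Odd p := (Fact.out : p.Prime).odd_of_ne_two hp
  induction N generalizing m with
  | zero =>
    simp only [truncScalar, sum_blocks_succ, sum_singles_succ, add_pow_char, sum_pow_char,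
      mul_pow, weight_shift f v h, lamInvTwist_succ_eq_pow, Block.shift_last, rowW, rowV,
      dotProduct, Fin.sum_univ_two, Fin.sum_univ_three, Matrix.cons_val_zero, Matrix.cons_val_one,
      ha, ha', hodd.neg_pow, one_pow, ← pow_mul, pow_succ]
  | succ N ih =>
    have h2 : (2 : R) ^ p = 2 := by
      have := map_natCast (frobenius R p) 2
      rwa [frobenius_def, Nat.cast_ofNat] at this
    simp only [truncScalar, sum_blocks_succ, sum_pow_char, mul_pow, weight_shift f v h,
      Block.shift_last, ih, h2]

theorem truncSum_shift (hp : p ≠ 2) (h : lam ^ p = -lam) (h2 : f (half p) * 2 = 1)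
    {a : ℕ → Fin 2 → R} {a' : ℕ → Fin 3 → R}
    (ha : ∀ κ i, a κ i ^ p = a κ i) (ha' : ∀ κ i, a' κ i ^ p = a' κ i) (M K n m : ℕ) :
    truncSum p lam f v (M + 1) K a a' n (m + 1) = truncSum p lam f v M K a a' n m ^ p := by
  have h3 : (2 : R) ^ p = 2 := by
    have := map_natCast (frobenius R p) 2
    rwa [frobenius_def, Nat.cast_ofNat] at this
  have h4 : f (half p) ^ p = f (half p) := by
    have h5 : f (half p) ^ p * 2 = 1 := by
      conv_lhs => rw [← h3, ← mul_pow, h2, one_pow]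
    linear_combination f (half p) * h5 - f (half p) ^ p * h2
  simp only [truncSum, sum_pow_char, mul_pow, truncScalar_shift f v hp h (ha _) (ha' _), ← pow_mul,
    mul_comm _ p]
  simp only [pow_mul, h4]

theorem truncSum_add (hp : p ≠ 2) (h : lam ^ p = -lam) (h2 : f (half p) * 2 = 1)
    {a : ℕ → Fin 2 → R} {a' : ℕ → Fin 3 → R}
    (ha : ∀ κ i, a κ i ^ p = a κ i) (ha' : ∀ κ i, a' κ i ^ p = a' κ i) (M K n m : ℕ) :
    truncSum p lam f v (M + m) K a a' n m = truncSum p lam f v M K a a' n 0 ^ p ^ m := by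
  induction m with
  | zero => simp
  | succ m ih =>
    rw [← add_assoc, truncSum_shift f v hp h h2 ha ha', ih, ← pow_mul, pow_succ]

end frobenius

end transfer

/-! ### Truncation of the series `G` -/

section truncation

/-- The power series of order at least `D`. -/
def orderIdeal (A : Type*) [CommRing A] (D : ℕ) : Ideal (MvPowerSeries (Fin 3) A) where
  carrier := {g | (D : ℕ∞) ≤ g.order}
  add_mem' ha hb := (le_min ha hb).trans MvPowerSeries.min_order_le_add
  zero_mem' := by simp
  smul_mem' c _ hx := (hx.trans le_add_self).trans (MvPowerSeries.le_order_mul (f := c))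

theorem coeff_eq_zero_of_mem_orderIdeal {A : Type*} [CommRing A] {D : ℕ}
    {g : MvPowerSeries (Fin 3) A} (h : g ∈ orderIdeal A D) {m : Fin 3 →₀ ℕ} (hm : m.degree < D) :
    MvPowerSeries.coeff m g = 0 :=
  MvPowerSeries.coeff_of_lt_order (lt_of_lt_of_le (by exact_mod_cast hm) h)

variable {p : ℕ} [Fact p.Prime] {k : Type*} [Field k] [CharP k p] (lam : k)

/-- Since `p ^ i ≥ i + 1`, indices at least `M` do not affect coefficients of degree below `M`. This
crude bound is all that the truncation needs. -/
theorem xyz_pow_mem_orderIdeal {D i : ℕ} (h : D ≤ i + 1) (a : Fin 3) :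
    (xyz p a ^ p ^ i : MvPowerSeries (Fin 3) (WittVector p k)) ∈ orderIdeal _ D := by
  have h1 : D ≤ p ^ i := h.trans (Nat.lt_pow_self (Fact.out : p.Prime).one_lt)
  refine le_trans (Nat.cast_le.2 h1) (MvPowerSeries.le_order_pow_of_constantCoeff_eq_zero _ ?_)
  exact MvPowerSeries.constantCoeff_X a

theorem matC_mem_orderIdeal {D i : ℕ} (h : D ≤ i + 1) (a : Fin 2) (b : Fin 3) :
    matC p lam (cst p) (xyz p) i a b ∈ orderIdeal (WittVector p k) D := by
  have h1 := xyz_pow_mem_orderIdeal (p := p) (k := k) h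
  fin_cases a <;> fin_cases b <;> simp only [matC, Fin.mk_one, Fin.zero_eta, Fin.reduceFinMk,
    Matrix.of_apply, Matrix.cons_val] <;>
    first | exact h1 _ | exact Ideal.mul_mem_left _ _ (h1 _)

theorem matB_mem_orderIdeal {D i : ℕ} (h : D ≤ i + 1) (a : Fin 3) (b : Fin 2) :
    matB p lam (cst p) (xyz p) i a b ∈ orderIdeal (WittVector p k) D := by
  have h1 := xyz_pow_mem_orderIdeal (p := p) (k := k) h
  fin_cases a <;> fin_cases b <;> simp only [matB, Fin.mk_one, Fin.zero_eta, Fin.reduceFinMk,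
    Matrix.of_apply, Matrix.cons_val, neg_mem_iff] <;>
    first
    | exact h1 _
    | exact Ideal.mul_mem_left _ _ (h1 _)
    | exact Ideal.mul_mem_left _ _ (Ideal.mul_mem_left _ _ (h1 _))

theorem beta_mem_orderIdeal {D i : ℕ} (h : D ≤ i + 1) :
    beta p lam (cst p) (xyz p) i ∈ orderIdeal (WittVector p k) D := by
  have h1 := xyz_pow_mem_orderIdeal (p := p) (k := k) h
  exact add_mem (Ideal.mul_mem_left _ _ (h1 _))
    (Ideal.mul_mem_left _ _ (Ideal.pow_mem_of_mem _ (h1 _) 2 (by norm_num)))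

theorem blockMat_mem_orderIdeal {D : ℕ} {b : Block} (h : D ≤ b.last + 1) (i j : Fin 2) :
    blockMat p lam (cst p) (xyz p) b i j ∈ orderIdeal (WittVector p k) D := by
  cases b with
  | single n =>
    rw [blockMat, matE, Matrix.smul_apply, smul_eq_mul]
    exact Ideal.mul_mem_right _ _ (beta_mem_orderIdeal lam h)
  | pair i' n =>
    rw [blockMat, Matrix.mul_apply]
    exact sum_mem fun s _ => Ideal.mul_mem_left _ _ (matB_mem_orderIdeal lam h _ _)

theorem systemMat_mem_orderIdeal {D : ℕ} {l : List Block} {b : Block} (hb : b ∈ l)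
    (h : D ≤ b.last + 1) (i j : Fin 2) :
    systemMat p lam (cst p) (xyz p) l i j ∈ orderIdeal (WittVector p k) D := by
  induction l generalizing i with
  | nil => simp at hb
  | cons b' l ih =>
    rw [systemMat_cons, Matrix.mul_apply]
    refine sum_mem fun s _ => ?_
    rcases List.mem_cons.1 hb with rfl | hb
    · exact Ideal.mul_mem_right _ _ (blockMat_mem_orderIdeal lam h _ _)
    · exact Ideal.mul_mem_left _ _ (ih hb _)

theorem matA_eq_systemMat (l : List Block) :
    matA p lam l = systemMat p lam (cst p) (xyz p) l := by
  have : Block.mat p lam = blockMat p lam (cst p) (xyz p) := by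
    funext b
    cases b <;> rfl
  rw [matA, systemMat, this]

theorem coeff_matXEven {M N : ℕ} {m : Fin 3 →₀ ℕ} (hm : m.degree < M) (i j : Fin 2) :
    MvPowerSeries.coeff m (matXEven p lam (N + 1) i j) =
      ∑ l ∈ systems M (N + 1) 0,
        MvPowerSeries.coeff m (systemMat p lam (cst p) (xyz p) l i j) := by
  change ∑ᶠ l ∈ {l : List Block | Admissible l ∧ l.length = N + 1 ∧ MinEven l},
    MvPowerSeries.coeff m (matA p lam l i j) = _
  simp only [matA_eq_systemMat]
  apply finsum_mem_eq_sum_of_inter_support_eq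
  ext l
  simp only [Set.mem_inter_iff, Set.mem_ofPred_eq, SetLike.mem_coe, mem_systems,
    Function.mem_support]
  refine and_congr_left fun hs => ?_
  have h1 := admissible_and_minEven_iff l
  constructor
  · rintro ⟨h2, h3, h4⟩
    refine ⟨(h1.1 ⟨h2, h4⟩).2, h3, fun b hb => ?_⟩
    by_contra hlt
    exact hs (coeff_eq_zero_of_mem_orderIdeal
      (systemMat_mem_orderIdeal lam hb (D := M) (by omega) i j) hm)
  · rintro ⟨h2, h3, -⟩
    have h4 := h1.2 ⟨by rintro rfl; simp at h3, h2⟩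
    exact ⟨h4.1, h3, h4.2⟩

theorem coeff_matYEven {M N : ℕ} {m : Fin 3 →₀ ℕ} (hm : m.degree < M) (i : Fin 2) (j : Fin 3) :
    MvPowerSeries.coeff m (matYEven p lam (N + 1) i j) =
      ∑ q ∈ markedSystems M (N + 1) 0, MvPowerSeries.coeff m
        ((systemMat p lam (cst p) (xyz p) q.1 * matC p lam (cst p) (xyz p) q.2) i j) := by
  change ∑ᶠ q ∈ {q : List Block × ℕ | Admissible (q.1 ++ [Block.single q.2]) ∧
      (q.1 ++ [Block.single q.2]).length = N + 1 ∧ MinEven (q.1 ++ [Block.single q.2])},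
    MvPowerSeries.coeff m ((matA p lam q.1 * matC p lam (cst p) (xyz p) q.2) i j) = _
  simp only [matA_eq_systemMat]
  apply finsum_mem_eq_sum_of_inter_support_eq
  ext q
  simp only [Set.mem_inter_iff, Set.mem_ofPred_eq, SetLike.mem_coe, mem_markedSystems,
    Function.mem_support]
  refine and_congr_left fun hs => ?_
  have h1 := admissible_and_minEven_iff (q.1 ++ [Block.single q.2])
  constructor
  · rintro ⟨h2, h3, h4⟩
    refine ⟨(h1.1 ⟨h2, h4⟩).2, h3, fun b hb => ?_⟩
    by_contra hlt
    apply hs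
    apply coeff_eq_zero_of_mem_orderIdeal (D := M) _ hm
    rw [Matrix.mul_apply]
    refine sum_mem fun s _ => ?_
    rcases List.mem_append.1 hb with hb | hb
    · exact Ideal.mul_mem_right _ _ (systemMat_mem_orderIdeal lam hb (by omega) _ _)
    · obtain rfl := List.mem_singleton.1 hb
      exact Ideal.mul_mem_left _ _ (matC_mem_orderIdeal lam (not_lt.1 hlt |>.trans
        (Nat.le_succ _)) _ _)
  · rintro ⟨h2, h3, -⟩
    have h4 := h1.2 ⟨by simp, h2⟩
    exact ⟨h4.1, h3, h4.2⟩

theorem systems_eq_empty {M N : ℕ} (h : M < N) : systems M N 0 = ∅ := by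
  refine Finset.eq_empty_of_forall_notMem fun l hl => ?_
  obtain ⟨h1, h2, h3⟩ := mem_systems.1 hl
  rcases List.eq_nil_or_concat' l with rfl | ⟨l', b, rfl⟩
  · simp at h2; omega
  · have h4 := h1.le_last
    have h5 := h3 b (by simp)
    simp at h2
    omega

theorem markedSystems_eq_empty {M N : ℕ} (h : M < N + 1) : markedSystems M (N + 1) 0 = ∅ := by
  refine Finset.eq_empty_of_forall_notMem fun q hq => ?_
  obtain ⟨h1, h2, h3⟩ := mem_markedSystems.1 hq
  have h4 := h1.le_last
  have h5 := h3 (Block.single q.2) (by simp)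
  simp at h2
  omega

/-- The Teichmüller lifts of the `κ`-th digits of the first two coordinates. -/
def digitsL (ω : Idx → ℤ_[p]) (κ : ℕ) : Fin 2 → WittVector p k :=
  fun j => teichDigitLift p (ω (Sum.inl j)) κ

/-- The Teichmüller lifts of the `κ`-th digits of the last three coordinates. -/
def digitsR (ω : Idx → ℤ_[p]) (κ : ℕ) : Fin 3 → WittVector p k :=
  fun j => teichDigitLift p (ω (Sum.inr j)) κ

/-- The contribution to the series `G` of the systems with indices below `M` and of the first `K`
digits. -/
def truncSeries (M K n : ℕ) (ω : Idx → ℤ_[p]) : MvPowerSeries (Fin 3) (WittVector p k) :=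
  ∑ κ ∈ Finset.range K, cst p (half p) ^ (n + 1 + κ) *
    truncCol p lam (cst p) (xyz p) M (n + 1 + κ) 0 (cst p ∘ digitsL ω κ) (cst p ∘ digitsR ω κ) 0

theorem coeff_truncCol {M N : ℕ} {m : Fin 3 →₀ ℕ} (hm : m.degree < M) (i : Fin 2)
    (a : Fin 2 → WittVector p k) (a' : Fin 3 → WittVector p k) :
    MvPowerSeries.coeff m
        (truncCol p lam (cst p) (xyz p) M (N + 1) 0 (cst p ∘ a) (cst p ∘ a') i) =
      ∑ j : Fin 2, MvPowerSeries.coeff m (matXEven p lam (N + 1) i j) * a j +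
        ∑ j : Fin 3, MvPowerSeries.coeff m (matYEven p lam (N + 1) i j) * a' j := by
  simp only [truncCol, Pi.add_apply, map_add, Matrix.mulVec, dotProduct, map_sum,
    Function.comp_apply, cst, MvPowerSeries.coeff_mul_C, Matrix.sum_apply]
  congr 1
  · exact Finset.sum_congr rfl fun j _ => by rw [coeff_matXEven lam hm]; rfl
  · exact Finset.sum_congr rfl fun j _ => by rw [coeff_matYEven lam hm]; rfl

/-- The digits from `K` on meet only systems of length greater than `M` with indices below `M`, and
there are none. -/
theorem coeff_seriesG {M K n : ℕ} {m : Fin 3 →₀ ℕ} (hm : m.degree < M) (hK : M ≤ K)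
    (ω : Idx → ℤ_[p]) :
    MvPowerSeries.coeff m (seriesG p lam (n + 1) ω) =
      MvPowerSeries.coeff m (truncSeries lam M K n ω) := by
  change ∑ᶠ κ : ℕ, half p ^ (n + 1 + κ) *
    (∑ j : Fin 2, MvPowerSeries.coeff m (matXEven p lam (n + 1 + κ) 0 j) * digitsL ω κ j
      + ∑ j : Fin 3, MvPowerSeries.coeff m (matYEven p lam (n + 1 + κ) 0 j) * digitsR ω κ j) = _
  have h1 (κ : ℕ) : n + 1 + κ = n + κ + 1 := by ring
  have h3 (N : ℕ) (g : MvPowerSeries (Fin 3) (WittVector p k)) :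
      MvPowerSeries.coeff m (cst p (half p) ^ N * g) =
        half p ^ N * MvPowerSeries.coeff m g := by
    rw [← map_pow]
    exact MvPowerSeries.coeff_C_mul _ _ _
  simp only [truncSeries, map_sum, h1, h3, coeff_truncCol lam hm]
  apply finsum_eq_sum_of_support_subset
  intro κ hκ
  by_contra hlt
  apply hκ
  have h2 : M < n + κ + 1 := by simp at hlt; omega
  simp only [coeff_matXEven lam hm, coeff_matYEven lam hm, systems_eq_empty h2,
    markedSystems_eq_empty h2, Finset.sum_empty, zero_mul, Finset.sum_const_zero, add_zero,
    mul_zero]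

end truncation

/-! ### Pullback to the curve -/

section pullback

variable {p : ℕ} [Fact p.Prime] {k : Type*} [Field k] [CharP k p]

instance instCharPPowerSeries : CharP k⟦X⟧ p :=
  charP_of_injective_ringHom (PowerSeries.C_injective (R := k)) p

theorem X_pow_dvd_iff_le_order {φ : k⟦X⟧} {n : ℕ} :
    (PowerSeries.X : k⟦X⟧) ^ n ∣ φ ↔ (n : ℕ∞) ≤ φ.order := by
  rw [PowerSeries.order_eq_emultiplicity_X, pow_dvd_iff_le_emultiplicity]

theorem hasSubst_coord (c : FormalCurve k) : MvPowerSeries.HasSubst c.coord :=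
  MvPowerSeries.hasSubst_of_constantCoeff_zero c.coord_zero

variable (p) in
/-- The pullback `W[[x,y,z]] → k[[t]]` along a formal curve. -/
def pull (c : FormalCurve k) : MvPowerSeries (Fin 3) (WittVector p k) →+* k⟦X⟧ :=
  (MvPowerSeries.substAlgHom (hasSubst_coord c)).toRingHom.comp (modP p)

variable (p k) in
/-- The reduction `W → k → k[[t]]`. -/
def redC : WittVector p k →+* k⟦X⟧ := (PowerSeries.C (R := k)).comp WittVector.constantCoeff

theorem pull_apply (c : FormalCurve k) (g : MvPowerSeries (Fin 3) (WittVector p k)) :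
    pull p c g = MvPowerSeries.subst c.coord (modP p g) :=
  congrFun (MvPowerSeries.coe_substAlgHom (hasSubst_coord c)) _

theorem order_pull (c : FormalCurve k) (g : MvPowerSeries (Fin 3) (WittVector p k)) :
    (pull p c g).order = c.meet (modP p g) := by rw [pull_apply]; rfl

theorem pull_comp_cst (c : FormalCurve k) : (pull p c).comp (cst p) = redC p k := by
  ext1 a
  rw [RingHom.comp_apply, pull_apply, cst, modP, MvPowerSeries.map_C, MvPowerSeries.subst_C]
  rfl

theorem pull_xyz (c : FormalCurve k) (i : Fin 3) : pull p c (xyz p i) = c.coord i := by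
  rw [pull_apply, xyz, modP, MvPowerSeries.map_X, MvPowerSeries.subst_X (hasSubst_coord c)]

theorem X_pow_dvd_pull (c : FormalCurve k) {D : ℕ} {g : MvPowerSeries (Fin 3) (WittVector p k)}
    (h : g ∈ orderIdeal (WittVector p k) D) : (PowerSeries.X : k⟦X⟧) ^ D ∣ pull p c g := by
  rw [X_pow_dvd_iff_le_order, pull_apply, PowerSeries.order_eq_order]
  refine le_trans ?_ (MvPowerSeries.le_order_subst (hasSubst_coord c) _)
  have h1 : (1 : ℕ∞) ≤ ⨅ i, MvPowerSeries.order (c.coord i) :=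
    le_iInf fun i => MvPowerSeries.one_le_order_iff_constCoeff_eq_zero.2 (c.coord_zero i)
  calc (D : ℕ∞) = 1 * D := (one_mul _).symm
    _ ≤ (⨅ i, MvPowerSeries.order (c.coord i)) * (modP p g).order := mul_le_mul' h1 (le_trans h (MvPowerSeries.le_order_map _))

theorem redC_teichmuller (a : k) :
    redC p k (WittVector.teichmuller p a) = PowerSeries.C a := by
  rw [redC, RingHom.comp_apply]
  exact congrArg _ (WittVector.teichmuller_coeff_zero p a)

theorem pull_alpha (lam : k) (c : FormalCurve k) (i j : ℕ) :
    pull p c (alpha p lam (cst p) (xyz p) i j) = alpha p lam (redC p k) c.coord i j := by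
  rw [map_alpha, pull_comp_cst]
  simp only [pull_xyz]

theorem pull_beta (lam : k) (c : FormalCurve k) (i : ℕ) :
    pull p c (beta p lam (cst p) (xyz p) i) = beta p lam (redC p k) c.coord i := by
  rw [map_beta, pull_comp_cst]
  simp only [pull_xyz]

theorem numA_eq (lam : k) (c : FormalCurve k) :
    numA p lam c = (alpha p lam (redC p k) c.coord 0 1).order := by
  rw [← pull_alpha, order_pull, numA]

theorem numB_eq (lam : k) (c : FormalCurve k) :
    numB p lam c = (beta p lam (redC p k) c.coord 0).order := by
  rw [← pull_beta, order_pull, numB]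

/-- The pullback to the curve of the equation of `D_n(ω)`. -/
def locusOn (lam : k) (c : FormalCurve k) (n : ℕ) (ω : Idx → ℤ_[p]) : k⟦X⟧ :=
  pull p c (seriesG p lam n ω)

theorem order_locusOn (lam : k) (c : FormalCurve k) (n : ℕ) (ω : Idx → ℤ_[p]) :
    (locusOn lam c n ω).order = meetLocus p lam c n ω := order_pull c _

theorem pull_truncSeries (hp : p ≠ 2) {lam : k} (h0 : lam ≠ 0) (h : lam ^ p = -lam)
    (c : FormalCurve k) (M K n : ℕ) (ω : Idx → ℤ_[p]) :
    pull p c (truncSeries lam M K n ω) = truncSum p lam (redC p k) c.coord M K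
      (fun κ => redC p k ∘ digitsL ω κ) (fun κ => redC p k ∘ digitsR ω κ) n 0 := by
  have h1 (a : WittVector p k) : pull p c (cst p a) = redC p k a := by
    rw [← pull_comp_cst c]; rfl
  have h2 {ι : Type} (a : ι → WittVector p k) : pull p c ∘ cst p ∘ a = redC p k ∘ a := by
    funext i; exact h1 _
  simp only [truncSeries, truncSum, map_sum, map_mul, map_pow, h1, map_truncCol, pull_comp_cst,
    pull_xyz, h2]
  refine Finset.sum_congr rfl fun κ _ => ?_
  rw [show n + 1 + κ = n + κ + 1 by ring, truncCol_eq _ _ hp h0 h, Pi.smul_apply]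
  simp [colU]

theorem X_pow_dvd_locusOn_sub (lam : k) (c : FormalCurve k) {M K : ℕ} (hK : M ≤ K) (n : ℕ)
    (ω : Idx → ℤ_[p]) :
    (PowerSeries.X : k⟦X⟧) ^ M ∣ locusOn lam c (n + 1) ω - pull p c (truncSeries lam M K n ω) := by
  rw [locusOn, ← map_sub]
  refine X_pow_dvd_pull c (MvPowerSeries.nat_le_order fun m hm => ?_)
  rw [map_sub, coeff_seriesG lam hm hK, sub_self]

theorem truncSeries_mem_orderIdeal_one (lam : k) (M K n : ℕ) (ω : Idx → ℤ_[p]) :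
    truncSeries lam M K n ω ∈ orderIdeal (WittVector p k) 1 := by
  refine sum_mem fun κ _ => Ideal.mul_mem_left _ _ ?_
  rw [show n + 1 + κ = n + κ + 1 by ring]
  simp only [truncCol, Pi.add_apply, Matrix.mulVec, dotProduct, Matrix.sum_apply, Finset.sum_mul]
  refine add_mem (sum_mem fun j _ => sum_mem fun l hl => Ideal.mul_mem_right _ _ ?_)
    (sum_mem fun j _ => sum_mem fun q _ => Ideal.mul_mem_right _ _ ?_)
  · obtain ⟨-, h1, -⟩ := mem_systems.1 hl
    obtain ⟨b, hb⟩ := List.exists_mem_of_length_pos (l := l) (by omega)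
    exact systemMat_mem_orderIdeal lam hb (by omega) _ _
  · rw [Matrix.mul_apply]
    exact sum_mem fun s _ => Ideal.mul_mem_left _ _ (matC_mem_orderIdeal lam (by omega) _ _)

theorem X_dvd_locusOn (lam : k) (c : FormalCurve k) (n : ℕ) (ω : Idx → ℤ_[p]) :
    (PowerSeries.X : k⟦X⟧) ∣ locusOn lam c (n + 1) ω := by
  have h1 := X_pow_dvd_locusOn_sub lam c (le_refl 1) n ω
  have h2 := X_pow_dvd_pull c (truncSeries_mem_orderIdeal_one lam 1 1 n ω)
  rw [pow_one] at h1 h2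
  exact (dvd_sub_left h2).1 h1

theorem redC_teichDigitLift_pow (a : ℤ_[p]) (κ : ℕ) :
    redC p k (teichDigitLift p a κ) ^ p = redC p k (teichDigitLift p a κ) := by
  rw [teichDigitLift, ← map_pow, ← map_pow, ← map_pow, ZMod.pow_card]

/-- The recursion satisfied by the equations of the loci along a curve, up to any given order. -/
theorem exists_X_pow_dvd_locusOn_sub_sum [PerfectRing k p] (hp : p ≠ 2) {lam : k} (h0 : lam ≠ 0)
    (h : lam ^ p = -lam) (c : FormalCurve k) (n : ℕ) (ω : Idx → ℤ_[p]) (D : ℕ) :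
    ∃ M, 2 ≤ M ∧ (PowerSeries.X : k⟦X⟧) ^ D ∣ locusOn lam c (n + 2) ω -
      ∑ b ∈ blocks M 0, weight p lam (redC p k) c.coord b *
        locusOn lam c (n + 1) ω ^ p ^ (b.last + 1) := by
  -- With this bound, for each block either at least `D` indices remain after it, or `b.last + 1 ≥
  -- D`. The `+ 2` makes room for the leading blocks `{0}` and `(0,1)`.
  refine ⟨2 * D + 2, by omega, ?_⟩
  have hhalf : redC p k (half p) * 2 = 1 := by
    have := congrArg (redC p k) (half_mul_two (k := k) hp)
    rwa [map_mul, map_one, map_ofNat] at this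
  have h1 := X_pow_dvd_locusOn_sub lam c (le_refl (2 * D + 2)) (n + 1) ω
  rw [pull_truncSeries hp h0 h, truncSum_succ _ _ hhalf] at h1
  have h2 := (pow_dvd_pow (PowerSeries.X : k⟦X⟧) (show D ≤ 2 * D + 2 by omega)).trans h1
  rw [← sub_add_sub_cancel, ← Finset.sum_sub_distrib]
  refine dvd_add h2 (Finset.dvd_sum fun b hb => ?_)
  rw [← mul_sub]
  refine Dvd.dvd.mul_left ?_ _
  have hlast := (mem_blocks.1 hb).2.2.2
  obtain ⟨M, hM⟩ : ∃ M, 2 * D + 2 = M + (b.last + 1) := ⟨2 * D + 2 - (b.last + 1), by omega⟩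
  have h3 : truncSum p lam (redC p k) c.coord (2 * D + 2) (2 * D + 2)
      (fun κ => redC p k ∘ digitsL ω κ) (fun κ => redC p k ∘ digitsR ω κ) n (b.last + 1) =
      pull p c (truncSeries lam M (2 * D + 2) n ω) ^ p ^ (b.last + 1) := by
    rw [pull_truncSeries hp h0 h, ← truncSum_add _ _ hp h hhalf, ← hM]
    · exact fun κ i => redC_teichDigitLift_pow _ _
    · exact fun κ i => redC_teichDigitLift_pow _ _
  rw [h3]
  rcases Nat.lt_or_ge M D with hlt | hge
  · have h4 : D ≤ p ^ (b.last + 1) :=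
      le_trans (by omega) (Nat.lt_pow_self (Fact.out : p.Prime).one_lt).le
    have h5 := X_pow_dvd_pull c (truncSeries_mem_orderIdeal_one lam M (2 * D + 2) n ω)
    rw [pow_one] at h5
    exact dvd_sub ((pow_dvd_pow _ h4).trans (pow_dvd_pow_of_dvd h5 _))
      ((pow_dvd_pow _ h4).trans (pow_dvd_pow_of_dvd (X_dvd_locusOn lam c n ω) _))
  · have h6 := X_pow_dvd_locusOn_sub lam c (show M ≤ 2 * D + 2 by omega) n ω
    rw [dvd_sub_comm] at h6
    exact ((pow_dvd_pow _ hge).trans h6).trans (sub_dvd_pow_sub_pow _ _ _)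

/-- Multiplication by `p` shifts the Teichmüller digits by one, Frobenius being trivial on `𝔽_p`,
and only the sum of length and digit number matters. -/
theorem seriesG_p_smul (lam : k) (n : ℕ) (ω : Idx → ℤ_[p]) :
    seriesG p lam (n + 1) ((p : ℤ_[p]) • ω) = seriesG p lam (n + 2) ω := by
  have hmul (a : ℤ_[p]) : (WittVector.equiv p).symm ((p : ℤ_[p]) * a) =
      (WittVector.equiv p).symm a * p := by
    rw [map_mul, map_natCast, mul_comm]
  have hz (a : ℤ_[p]) : (teichDigitLift p ((p : ℤ_[p]) * a) 0 : WittVector p k) = 0 := by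
    rw [teichDigitLift, teichDigit, hmul, WittVector.mul_charP_coeff_zero, map_zero,
      WittVector.teichmuller_zero]
  have hs (a : ℤ_[p]) (κ : ℕ) : (teichDigitLift p ((p : ℤ_[p]) * a) (κ + 1) : WittVector p k) =
      teichDigitLift p a κ := by
    rw [teichDigitLift, teichDigit, hmul, WittVector.mul_charP_coeff_succ, ZMod.pow_card]
    rfl
  ext1 m
  -- One more digit is kept on the left, since the zeroth digit of `p ω` vanishes.
  rw [coeff_seriesG lam (Nat.lt_succ_self _) (Nat.le_succ _),
    coeff_seriesG lam (Nat.lt_succ_self _) le_rfl]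
  rw [truncSeries, Finset.sum_range_succ', truncSeries]
  have hL : digitsL ((p : ℤ_[p]) • ω) 0 = (0 : Fin 2 → WittVector p k) := by
    funext j; exact hz _
  have hR : digitsR ((p : ℤ_[p]) • ω) 0 = (0 : Fin 3 → WittVector p k) := by
    funext j; exact hz _
  have hLs (κ : ℕ) : digitsL (k := k) ((p : ℤ_[p]) • ω) (κ + 1) = digitsL ω κ := by
    funext j; exact hs _ _
  have hRs (κ : ℕ) : digitsR (k := k) ((p : ℤ_[p]) • ω) (κ + 1) = digitsR ω κ := by
    funext j; exact hs _ _
  have h0 {ι : Type} : (cst p ∘ (0 : ι → WittVector p k)) = 0 := by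
    funext j; exact map_zero _
  rw [hL, hR, h0, h0]
  simp only [hLs, hRs]
  congr 1
  rw [truncCol, Matrix.mulVec_zero, Matrix.mulVec_zero, add_zero 0, Pi.zero_apply, mul_zero, add_zero]
  refine Finset.sum_congr rfl fun κ _ => ?_
  rw [show n + 1 + (κ + 1) = n + 1 + 1 + κ by ring]

end pullback

/-! ### Orders along the curve -/

section isotropy

variable {p : ℕ} [Fact p.Prime] {A : Type*} [CommRing A] [CharP A p]

/-- With `φ` the Frobenius, `1 - (-φ)^j` telescopes into signed powers of `φ` applied to `1 + φ`. -/
theorem add_pow_char_dvd_sub (ζ : A) (j : ℕ) : ζ + ζ ^ p ∣ ζ - (-1) ^ j * ζ ^ p ^ j := by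
  induction j with
  | zero => simp
  | succ j ih =>
    have h1 : ζ - (-1) ^ (j + 1) * ζ ^ p ^ (j + 1) =
        (ζ - (-1) ^ j * ζ ^ p ^ j) + (-1) ^ j * (ζ + ζ ^ p) ^ p ^ j := by
      rw [add_pow_char_pow, ← pow_mul, ← pow_succ']
      ring
    rw [h1]
    exact dvd_add ih (Dvd.dvd.mul_left (dvd_pow_self _ (pow_pos (Fact.out : p.Prime).pos j).ne') _)

/-- Write `y = x η`, `z = x ζ`, `τ = η + ζ²`, `q = p ^ j`. Completing the square, the form equals `x
x^q (τ + τ^q - (ζ - (-1)^j ζ^q)²)`. Isotropy, `x² τ ∈ I`, disposes of the `τ` terms. The case `j =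
1` then gives `x x^p (ζ + ζ^p)² ∈ I`, which divides the square term for every `j ≥ 1`. -/
theorem form_mem_of_dvd (I : Ideal A) {x y z : A} (hy : x ∣ y) (hz : x ∣ z)
    (hβ : x * y + z ^ 2 ∈ I) (hα : x * y ^ p + x ^ p * y - 2 * (z * z ^ p) ∈ I) {j : ℕ}
    (hj : 1 ≤ j) : x * y ^ p ^ j + x ^ p ^ j * y + 2 * (-1) ^ j * (z * z ^ p ^ j) ∈ I := by
  obtain ⟨η, rfl⟩ := hy
  obtain ⟨ζ, rfl⟩ := hz
  have hsum {q : ℕ} (hq : ∃ i, q = p ^ i) {e : A} (he : e ^ 2 = 1) :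
      x * (x * η) ^ q + x ^ q * (x * η) + 2 * e * (x * ζ * (x * ζ) ^ q) +
        (x * x ^ q) * (ζ - e * ζ ^ q) ^ 2 =
      (x * x ^ q) * (η + ζ ^ 2 + (η + ζ ^ 2) ^ q) := by
    obtain ⟨i, rfl⟩ := hq
    rw [add_pow_char_pow]
    linear_combination (x * x ^ p ^ i * (ζ ^ p ^ i) ^ 2) * he
  have hs {q : ℕ} (hq : 1 ≤ q) : (x * x ^ q) * (η + ζ ^ 2 + (η + ζ ^ 2) ^ q) ∈ I := by
    obtain ⟨r, rfl⟩ := Nat.exists_eq_add_of_le' hq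
    have : (x * x ^ (r + 1)) * (η + ζ ^ 2 + (η + ζ ^ 2) ^ (r + 1)) =
        (x ^ r * (1 + (η + ζ ^ 2) ^ r)) * (x * (x * η) + (x * ζ) ^ 2) := by ring
    rw [this]
    exact Ideal.mul_mem_left _ _ hβ
  have hδ : (x * x ^ p) * (ζ + ζ ^ p) ^ 2 ∈ I := by
    have h1 := hsum ⟨1, (pow_one p).symm⟩ (e := -1) (by ring)
    have h2 := sub_mem (hs (Fact.out : p.Prime).one_le) hα
    rw [← h1] at h2
    convert h2 using 1
    ring
  have h1 := hsum ⟨j, rfl⟩ (e := (-1) ^ j) (by rw [← pow_mul, mul_comm, pow_mul]; simp)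
  rw [eq_sub_of_add_eq h1]
  refine sub_mem (hs (pow_pos (Fact.out : p.Prime).pos j)) ?_
  refine Ideal.mem_of_dvd I ?_ hδ
  refine mul_dvd_mul (mul_dvd_mul_left _ (pow_dvd_pow _ ?_)) (pow_dvd_pow_of_dvd
    (add_pow_char_dvd_sub ζ j) 2)
  exact Nat.le_self_pow (by omega) p

theorem form_mem_of_dvd' (I : Ideal A) {x y z : A} (h2 : z ^ 2 ∈ I) (hx : z ∣ x) (hy : z ∣ y)
    (j : ℕ) : x * y ^ p ^ j + x ^ p ^ j * y + 2 * (-1) ^ j * (z * z ^ p ^ j) ∈ I := by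
  have hq : p ^ j ≠ 0 := (pow_pos (Fact.out : p.Prime).pos j).ne'
  have h3 {a b : A} (ha : z ∣ a) (hb : z ∣ b) : a * b ∈ I :=
    Ideal.mem_of_dvd I (by rw [sq]; exact mul_dvd_mul ha hb) h2
  exact add_mem (add_mem (h3 hx (dvd_pow hy hq)) (h3 (dvd_pow hx hq) hy))
    (Ideal.mul_mem_left _ _ (h3 dvd_rfl (dvd_pow dvd_rfl hq)))

/-- In a valuation ring, if a vector is isotropic and orthogonal to its Frobenius twist modulo an
ideal, then it is orthogonal to all of its Frobenius twists modulo that ideal. -/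
theorem form_mem [IsDomain A] [ValuationRing A] (I : Ideal A) {x y z : A}
    (hβ : x * y + z ^ 2 ∈ I) (hα : x * y ^ p + x ^ p * y - 2 * (z * z ^ p) ∈ I) {j : ℕ}
    (hj : 1 ≤ j) : x * y ^ p ^ j + x ^ p ^ j * y + 2 * (-1) ^ j * (z * z ^ p ^ j) ∈ I := by
  wlog hxy : x ∣ y generalizing x y
  · have h1 := this (x := y) (y := x) (by rwa [mul_comm]) (by convert hα using 1; ring)
      ((ValuationRing.dvd_total x y).resolve_left hxy)
    convert h1 using 1
    ring
  by_cases hxz : x ∣ z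
  · exact form_mem_of_dvd I hxy hxz hβ hα hj
  · obtain ⟨ξ, rfl⟩ := (ValuationRing.dvd_total x z).resolve_left hxz
    obtain ⟨η, rfl⟩ := hxy
    refine form_mem_of_dvd' I ?_ (dvd_mul_right _ _) ((dvd_mul_right _ _).mul_right _) j
    have hξ : ¬ IsUnit ξ := by
      rintro ⟨u, rfl⟩
      exact hxz ⟨↑u⁻¹, by rw [mul_assoc, Units.mul_inv, mul_one]⟩
    -- When `z` has strictly the least valuation, the isotropy condition is `z²` times this unit, so
    -- `z² ∈ I` and every product of two coordinates lies in `I`.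
    have hu : IsUnit (1 + ξ * (ξ * η)) := by
      have h1 : ¬ IsUnit (ξ * (ξ * η)) := fun h => hξ (isUnit_of_mul_isUnit_left h)
      by_contra h
      have h2 := IsLocalRing.nonunits_add (a := 1 + ξ * (ξ * η)) (b := -(ξ * (ξ * η))) h
        (by rwa [mem_nonunits_iff, IsUnit.neg_iff])
      rw [add_neg_cancel_right] at h2
      exact h2 isUnit_one
    obtain ⟨u, hu⟩ := hu
    have h3 : z ^ 2 = ↑u⁻¹ * (z * ξ * (z * ξ * η) + z ^ 2) := by
      rw [show z * ξ * (z * ξ * η) + z ^ 2 = ↑u * z ^ 2 by rw [hu]; ring, Units.inv_mul_cancel_left]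
    rw [h3]
    exact Ideal.mul_mem_left _ _ hβ

end isotropy

/-! ### Orders of the terms of the recursion along a curve -/

section orders

variable {p : ℕ} [Fact p.Prime] {k : Type*} [Field k] [CharP k p] {lam : k}

theorem order_C_mul {a : k} (ha : a ≠ 0) (g : k⟦X⟧) : (PowerSeries.C a * g).order = g.order := by
  rw [PowerSeries.order_mul, PowerSeries.order_zero_of_unit, zero_add]
  exact (isUnit_iff_ne_zero.2 ha).map PowerSeries.C

/-- Rescaling `z` by `μ = 1/(2λ)` turns `β_0` into `x y + z²`. As `μ ^ p = -μ`, the mixed term of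
`α_{0,j}` acquires the sign `(-1)^j`, which is the shape treated by `form_mem`. -/
theorem alpha_zero_mem (hp : p ≠ 2) (h : lam ^ p = -lam) (v : Fin 3 → k⟦X⟧) (I : Ideal k⟦X⟧)
    (hβ : beta p lam (redC p k) v 0 ∈ I) (hα : alpha p lam (redC p k) v 0 1 ∈ I) {j : ℕ}
    (hj : 1 ≤ j) : alpha p lam (redC p k) v 0 j ∈ I := by
  set μ : k := (2 * lam)⁻¹ with hμ
  have h2 : (2 : k) ^ p = 2 := by
    have := map_natCast (frobenius k p) 2
    rwa [frobenius_def, Nat.cast_ofNat] at this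
  have hμp : μ ^ p = -μ := by rw [hμ, inv_pow, mul_pow, h, h2, mul_neg, inv_neg]
  have hμj (j : ℕ) : μ ^ p ^ j = (-1) ^ j * μ := by
    induction j with
    | zero => simp
    | succ j ih => rw [pow_char_pow_succ hp hμp, ih]; ring
  have hμ4 : (4 * lam ^ 2)⁻¹ = μ ^ 2 := by rw [hμ, inv_pow, mul_pow]; norm_num
  have hμ2 : (2 * lam ^ 2)⁻¹ = 2 * μ ^ 2 := by
    have := two_ne_zero_of_odd (k := k) hp
    rw [← hμ4, mul_inv, mul_inv, ← mul_assoc, show (4 : k) = 2 * 2 by norm_num, mul_inv,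
      ← mul_assoc, mul_inv_cancel₀ this, one_mul]
  have hα' (j : ℕ) : alpha p lam (redC p k) v 0 j = v 0 * v 1 ^ p ^ j + v 0 ^ p ^ j * v 1 +
      2 * (-1) ^ j * ((PowerSeries.C μ * v 2) * (PowerSeries.C μ * v 2) ^ p ^ j) := by
    rw [alpha, redC_teichmuller, hμ2, mul_pow, ← map_pow, hμj]
    simp only [pow_zero, pow_one, map_mul, map_pow, map_neg, map_one, map_ofNat]
    have h1 : ((-1 : k⟦X⟧) ^ j) * (-1) ^ j = 1 := by rw [← mul_pow]; simp
    linear_combination (-2 * PowerSeries.C μ ^ 2 * v 2 * v 2 ^ p ^ j) * h1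
  have hβ' : beta p lam (redC p k) v 0 = v 0 * v 1 + (PowerSeries.C μ * v 2) ^ 2 := by
    rw [beta, redC_teichmuller, hμ4, mul_pow, map_pow]
    simp
  rw [hα'] at hα ⊢
  rw [hβ'] at hβ
  refine form_mem I hβ ?_ hj
  rw [pow_one] at hα
  convert hα using 1
  ring

theorem min_order_le_order_alpha (hp : p ≠ 2) (h : lam ^ p = -lam) (v : Fin 3 → k⟦X⟧) {j : ℕ}
    (hj : 1 ≤ j) : min (alpha p lam (redC p k) v 0 1).order (beta p lam (redC p k) v 0).order ≤
      (alpha p lam (redC p k) v 0 j).order := by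
  refine ENat.forall_natCast_le_iff_le.1 fun D hD => ?_
  rw [le_min_iff, ← X_pow_dvd_iff_le_order, ← X_pow_dvd_iff_le_order,
    ← Ideal.mem_span_singleton, ← Ideal.mem_span_singleton] at hD
  rw [← X_pow_dvd_iff_le_order, ← Ideal.mem_span_singleton]
  exact alpha_zero_mem hp h v _ hD.2 hD.1 hj

theorem alpha_add (h : lam ^ p = -lam) (v : Fin 3 → k⟦X⟧) (i d : ℕ) :
    alpha p lam (redC p k) v i (i + d) = alpha p lam (redC p k) v 0 d ^ p ^ i := by
  induction i with
  | zero => simp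
  | succ i ih => rw [add_right_comm, alpha_succ _ _ h, ih, ← pow_mul, pow_succ]

theorem beta_eq_pow (h : lam ^ p = -lam) (v : Fin 3 → k⟦X⟧) (i : ℕ) :
    beta p lam (redC p k) v i = beta p lam (redC p k) v 0 ^ p ^ i := by
  induction i with
  | zero => simp
  | succ i ih => rw [beta_succ _ _ h, ih, ← pow_mul, pow_succ]

theorem order_weight_pair (h0 : lam ≠ 0) (v : Fin 3 → k⟦X⟧) (i j : ℕ) :
    (weight p lam (redC p k) v (.pair i j)).order = (alpha p lam (redC p k) v i j).order := by
  rw [weight, lamInvTwist, lamTwist, redC_teichmuller, redC_teichmuller, ← map_mul, order_C_mul]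
  exact mul_ne_zero (pow_ne_zero _ (inv_ne_zero h0)) (pow_ne_zero _ h0)

/-- The terms of the recursion along a curve, apart from the first two, have larger order. -/
theorem min_order_add_one_le_order_weight_mul (hp : p ≠ 2) (h0 : lam ≠ 0) (h : lam ^ p = -lam)
    (v : Fin 3 → k⟦X⟧) {g : k⟦X⟧} (hg : 1 ≤ g.order) {M : ℕ} {b : Block} (hb : b ∈ blocks M 0)
    (hb0 : b ≠ .single 0) (hb1 : b ≠ .pair 0 1) :
    min ((beta p lam (redC p k) v 0).order + p * g.order)
      ((alpha p lam (redC p k) v 0 1).order + p ^ 2 * g.order) + 1 ≤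
      (weight p lam (redC p k) v b * g ^ p ^ (b.last + 1)).order := by
  set A := (alpha p lam (redC p k) v 0 1).order
  set B := (beta p lam (redC p k) v 0).order
  set μ := min (B + p * g.order) (A + p ^ 2 * g.order) with hμ
  have hp3 : 2 ≤ p := (Fact.out : p.Prime).two_le
  have hμ1 : 1 ≤ μ := by
    have h1 : (1 : ℕ∞) ≤ p := by exact_mod_cast (show 1 ≤ p by omega)
    refine le_min ?_ ?_
    · exact (one_le_mul h1 hg).trans le_add_self
    · exact (one_le_mul (one_le_pow₀ h1) hg).trans le_add_self
  -- A block whose first index is positive is a Frobenius twist, which at least doubles an order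
  -- that is already `≥ μ ≥ 1`.
  have hpow {i : ℕ} (hi : 1 ≤ i) {t : ℕ∞} (ht : μ ≤ t) : μ + 1 ≤ (p ^ i : ℕ) * t := by
    have h1 : 2 ≤ p ^ i := hp3.trans (Nat.le_self_pow (by omega) p)
    calc μ + 1 ≤ μ + μ := by gcongr
      _ = (2 : ℕ) * μ := by push_cast; rw [two_mul]
      _ ≤ (p ^ i : ℕ) * t := by gcongr
  -- The order of `α_{0,d}` is at least `A` or at least `B`. In the second case the larger power of
  -- `g` already gives a strict gain over `B + p * g.order`.
  have hpair {d : ℕ} (hd : 1 ≤ d) : min (B + p * g.order + 1) (A + p ^ (d + 1) * g.order) ≤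
      (alpha p lam (redC p k) v 0 d).order + p ^ (d + 1) * g.order := by
    have h1 : min A B ≤ (alpha p lam (redC p k) v 0 d).order := min_order_le_order_alpha hp h v hd
    rcases min_le_iff.1 h1 with h1 | h1
    · exact (min_le_right _ _).trans (by gcongr)
    · refine (min_le_left _ _).trans ?_
      have h2 : p + 1 ≤ p ^ (d + 1) := by
        have : p ^ 2 ≤ p ^ (d + 1) := Nat.pow_le_pow_right (by omega) (by omega)
        nlinarith
      have h3 : (p : ℕ∞) * g.order + 1 ≤ p ^ (d + 1) * g.order := by
        calc (p : ℕ∞) * g.order + 1 ≤ p * g.order + g.order := by gcongr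
          _ = ((p + 1 : ℕ) : ℕ∞) * g.order := by push_cast; ring
          _ ≤ ((p ^ (d + 1) : ℕ) : ℕ∞) * g.order := by gcongr
          _ = _ := by push_cast; rfl
      rw [add_assoc]
      exact add_le_add h1 h3
  obtain ⟨hval, -, heven, -⟩ := mem_blocks.1 hb
  cases b with
  | single i =>
    have hi : 1 ≤ i := Nat.one_le_iff_ne_zero.2 fun hi => hb0 (by rw [hi])
    have h1 : weight p lam (redC p k) v (.single i) * g ^ p ^ (i + 1) =
        (beta p lam (redC p k) v 0 * g ^ p) ^ p ^ i := by
      rw [weight, beta_eq_pow h, mul_pow, ← pow_mul, pow_succ']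
    rw [Block.last, h1, PowerSeries.order_pow, PowerSeries.order_mul, PowerSeries.order_pow,
      nsmul_eq_mul, nsmul_eq_mul]
    exact hpow hi (min_le_left _ _)
  | pair i j =>
    obtain ⟨d, rfl⟩ := Nat.exists_eq_add_of_le (Nat.le_of_lt hval)
    have hd : 1 ≤ d := by simp only [Block.Valid] at hval; omega
    have h1 : (weight p lam (redC p k) v (.pair i (i + d)) * g ^ p ^ (i + d + 1)).order =
        (p ^ i : ℕ) * ((alpha p lam (redC p k) v 0 d).order + p ^ (d + 1) * g.order) := by
      rw [PowerSeries.order_mul, order_weight_pair h0, alpha_add h, PowerSeries.order_pow,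
        PowerSeries.order_pow, nsmul_eq_mul, nsmul_eq_mul, mul_add]
      push_cast
      ring
    rw [Block.last, h1]
    rcases Nat.eq_zero_or_pos i with rfl | hi
    · have hd2 : 2 ≤ d := by
        by_contra hlt
        apply hb1
        rw [show d = 1 by omega]
      rw [pow_zero, Nat.cast_one, one_mul]
      refine le_trans ?_ (hpair hd)
      refine le_min (add_le_add_left (min_le_left _ _) 1) ?_
      refine (add_le_add_left (min_le_right _ _) 1).trans ?_
      have h2 : p ^ 2 + 1 ≤ p ^ (d + 1) := Nat.pow_lt_pow_right hp3 (by omega)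
      rw [add_assoc]
      gcongr
      calc (p : ℕ∞) ^ 2 * g.order + 1 ≤ p ^ 2 * g.order + g.order := by gcongr
        _ = ((p ^ 2 + 1 : ℕ) : ℕ∞) * g.order := by push_cast; ring
        _ ≤ ((p ^ (d + 1) : ℕ) : ℕ∞) * g.order := by gcongr
        _ = _ := by push_cast; rfl
    · refine hpow hi (le_trans ?_ (hpair hd))
      refine le_min ((min_le_left _ _).trans le_self_add) ((min_le_right _ _).trans ?_)
      gcongr
      · exact_mod_cast (show 1 ≤ p by omega)
      · omega

/-- Modulo terms of order above the minimum, `T` is the sum of the two leading terms; these can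
cancel only if their orders agree. Working modulo each `X ^ D` also covers infinite orders. -/
theorem min_le_order_of_recursion (hp : p ≠ 2) (h0 : lam ≠ 0) (h : lam ^ p = -lam)
    (v : Fin 3 → k⟦X⟧) {g T : k⟦X⟧} (hg : 1 ≤ g.order)
    (hT : ∀ D : ℕ, ∃ M, 2 ≤ M ∧ (PowerSeries.X : k⟦X⟧) ^ D ∣ T -
      ∑ b ∈ blocks M 0, weight p lam (redC p k) v b * g ^ p ^ (b.last + 1)) :
    let μ₀ := (beta p lam (redC p k) v 0).order + p * g.order
    let μ₁ := (alpha p lam (redC p k) v 0 1).order + p ^ 2 * g.order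
    min μ₀ μ₁ ≤ T.order ∧ (μ₀ ≠ μ₁ → T.order = min μ₀ μ₁) := by
  intro μ₀ μ₁
  set t : Block → k⟦X⟧ := fun b => weight p lam (redC p k) v b * g ^ p ^ (b.last + 1) with ht
  have ht0 : (t (.single 0)).order = μ₀ := by
    simp only [ht, weight, Block.last, zero_add, pow_one, PowerSeries.order_mul,
      PowerSeries.order_pow, nsmul_eq_mul, μ₀]
  have ht1 : (t (.pair 0 1)).order = μ₁ := by
    simp only [ht, Block.last, one_add_one_eq_two, PowerSeries.order_mul, order_weight_pair h0,
      PowerSeries.order_pow, nsmul_eq_mul, μ₁, Nat.cast_pow]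
  have hmem {M : ℕ} (hM : 2 ≤ M) : Block.single 0 ∈ blocks M 0 ∧ Block.pair 0 1 ∈ blocks M 0 := by
    simp [mem_blocks, Block.Valid, Block.first, Block.last]
    omega
  have hrest {M : ℕ} (hM : 2 ≤ M) {D : ℕ} (hD : (D : ℕ∞) ≤ min μ₀ μ₁ + 1) :
      (PowerSeries.X : k⟦X⟧) ^ D ∣ ∑ b ∈ blocks M 0, t b - (t (.single 0) + t (.pair 0 1)) := by
    classical
    have h1 : {Block.single 0, Block.pair 0 1} ⊆ blocks M 0 := by
      simpa [Finset.insert_subset_iff] using hmem hM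
    rw [← Finset.sum_pair (f := t) (by simp), ← Finset.sum_sdiff h1, add_sub_cancel_right]
    refine Finset.dvd_sum fun b hb => ?_
    simp only [Finset.mem_sdiff, Finset.mem_insert, Finset.mem_singleton, not_or] at hb
    rw [X_pow_dvd_iff_le_order]
    exact hD.trans (min_order_add_one_le_order_weight_mul hp h0 h v hg hb.1 hb.2.1 hb.2.2)
  have hkey {D : ℕ} (hD : (D : ℕ∞) ≤ min μ₀ μ₁ + 1) :
      (PowerSeries.X : k⟦X⟧) ^ D ∣ T - (t (.single 0) + t (.pair 0 1)) := by
    obtain ⟨M, hM, hdvd⟩ := hT D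
    have := dvd_add hdvd (hrest hM hD)
    rwa [sub_add_sub_cancel] at this
  have hge : min μ₀ μ₁ ≤ T.order := by
    refine ENat.forall_natCast_le_iff_le.1 fun D hD => ?_
    rw [← X_pow_dvd_iff_le_order]
    refine (dvd_sub_left ?_).1 (hkey (hD.trans le_self_add))
    refine dvd_add ?_ ?_ <;> rw [X_pow_dvd_iff_le_order]
    · exact ht0 ▸ hD.trans (min_le_left _ _)
    · exact ht1 ▸ hD.trans (min_le_right _ _)
  refine ⟨hge, fun hne => le_antisymm ?_ hge⟩
  have hsum : (t (.single 0) + t (.pair 0 1)).order = min μ₀ μ₁ := by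
    rw [PowerSeries.order_add_of_order_ne _ _ (by rwa [ht0, ht1]), ht0, ht1]
  by_contra hlt
  rw [not_le] at hlt
  obtain ⟨m, hm⟩ := ENat.ne_top_iff_exists.1 hlt.ne_top
  have h1 := hkey (D := m + 1) (by rw [← hm]; push_cast; rfl)
  have h2 : (PowerSeries.X : k⟦X⟧) ^ (m + 1) ∣ T := by
    rw [X_pow_dvd_iff_le_order]
    push_cast
    rw [hm]
    exact Order.add_one_le_of_lt hlt
  rw [dvd_sub_right h2, X_pow_dvd_iff_le_order, hsum, ← hm] at h1
  have h3 : m + 1 ≤ m := by exact_mod_cast h1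
  omega

end orders

/-! ### The order recursion -/

section recursion

/-- The quantity `A (1 + P² + ⋯ + P^(2n-2)) + d P^(2n)` is the `n`-th iterate of `u ↦ A + P² u`
at `d`. -/
theorem geom_step {S : Type*} [CommSemiring S] (P A d : S) (n : ℕ) :
    A * ∑ i ∈ Finset.range (n + 1), P ^ (2 * i) + d * P ^ (2 * (n + 1)) =
      A + P ^ 2 * (A * ∑ i ∈ Finset.range n, P ^ (2 * i) + d * P ^ (2 * n)) := by
  rw [Finset.sum_range_succ']
  simp only [mul_add, pow_add, ← Finset.sum_mul]
  ring

theorem geom_step' {S : Type*} [CommSemiring S] (P B D : S) (n : ℕ) :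
    B * ∑ i ∈ Finset.range (n + 1), P ^ i + D * P ^ (n + 1) =
      B + P * (B * ∑ i ∈ Finset.range n, P ^ i + D * P ^ n) := by
  rw [Finset.sum_range_succ']
  simp only [pow_succ, ← Finset.sum_mul]
  ring

variable {P : ℕ} {A B : ℕ∞} {V : ℕ → ℕ∞}

/-- With `B = ⊤` only the second term survives. A tie means that both are `⊤`, and then the lower
bound alone suffices. -/
theorem order_eq_of_top (hV : ∀ n, min (⊤ + P * V n) (A + P ^ 2 * V n) ≤ V (n + 1) ∧
      (⊤ + P * V n ≠ A + P ^ 2 * V n → V (n + 1) = min (⊤ + P * V n) (A + P ^ 2 * V n))) (n : ℕ) :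
    V n = A * ∑ i ∈ Finset.range n, (P : ℕ∞) ^ (2 * i) + V 0 * (P : ℕ∞) ^ (2 * n) := by
  induction n with
  | zero => simp
  | succ n ih =>
    rw [geom_step, ← ih]
    have h1 := hV n
    rw [top_add, min_eq_right le_top] at h1
    by_cases h2 : A + P ^ 2 * V n = ⊤
    · rw [h2] at h1 ⊢
      exact top_le_iff.1 h1.1
    · exact h1.2 (Ne.symm h2)

theorem geom_closed (q a d n : ℕ) :
    q * (q + 2) * (a * ∑ i ∈ Finset.range n, (q + 1) ^ (2 * i) + d * (q + 1) ^ (2 * n)) + a =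
      (a + q * (q + 2) * d) * (q + 1) ^ (2 * n) := by
  induction n with
  | zero => simp; ring
  | succ n ih =>
    rw [geom_step, show 2 * (n + 1) = 2 * n + 2 by ring, pow_add]
    linear_combination (q + 1) ^ 2 * ih

/-- Here `p = q + 1`, which avoids subtraction, and `h1`, `h2` are the bounds on `H_e`, `H_{e+1}`
multiplied by `p`. With `w_n` the iterates of `u ↦ a + p² u` at `d`, one has `H_{n+1} = (p + 1)(a +
p (p - 1) w_n)`. Thus comparing `(1 + p) B` with `H_{n+1}` is comparing the two leading orders at `V
n = w_n`. -/
theorem order_cases {q a b d e : ℕ} (hq : 1 ≤ q) (ha : 1 ≤ a) (hd : V 0 = d)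
    (hV : ∀ n, min ((b : ℕ∞) + (q + 1 : ℕ) * V n) (a + (q + 1 : ℕ) ^ 2 * V n) ≤ V (n + 1) ∧
      ((b : ℕ∞) + (q + 1 : ℕ) * V n ≠ a + (q + 1 : ℕ) ^ 2 * V n →
        V (n + 1) = min ((b : ℕ∞) + (q + 1 : ℕ) * V n) (a + (q + 1 : ℕ) ^ 2 * V n)))
    (h1 : a * (q + 1 + (q + 1) ^ (2 * e)) + (q + 1) ^ (2 * e) * (q * (q + 2)) * d ≤
      (q + 1) * (q + 2) * b)
    (h2 : (q + 1) * (q + 2) * b <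
      a * (q + 1 + (q + 1) ^ (2 * (e + 1))) + (q + 1) ^ (2 * (e + 1)) * (q * (q + 2)) * d) :
    (∀ n, n < e → V n = a * ∑ i ∈ Finset.range n, ((q + 1 : ℕ) : ℕ∞) ^ (2 * i) +
        V 0 * ((q + 1 : ℕ) : ℕ∞) ^ (2 * n)) ∧
      (∀ n, e ≤ n → V n = b * ∑ i ∈ Finset.range (n - e), ((q + 1 : ℕ) : ℕ∞) ^ i +
        V e * ((q + 1 : ℕ) : ℕ∞) ^ (n - e)) ∧
      a * ∑ i ∈ Finset.range e, ((q + 1 : ℕ) : ℕ∞) ^ (2 * i) +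
        V 0 * ((q + 1 : ℕ) : ℕ∞) ^ (2 * e) ≤ V e ∧
      (a * (q + 1 + (q + 1) ^ (2 * e)) + (q + 1) ^ (2 * e) * (q * (q + 2)) * d <
        (q + 1) * (q + 2) * b →
        V e = a * ∑ i ∈ Finset.range e, ((q + 1 : ℕ) : ℕ∞) ^ (2 * i) +
          V 0 * ((q + 1 : ℕ) : ℕ∞) ^ (2 * e)) := by
  set w : ℕ → ℕ := fun n => a * ∑ i ∈ Finset.range n, (q + 1) ^ (2 * i) + d * (q + 1) ^ (2 * n)
    with hw
  have hwcast (n : ℕ) : (a : ℕ∞) * ∑ i ∈ Finset.range n, ((q + 1 : ℕ) : ℕ∞) ^ (2 * i) +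
      V 0 * ((q + 1 : ℕ) : ℕ∞) ^ (2 * n) = (w n : ℕ) := by
    rw [hd, hw]
    push_cast
    rfl
  simp only [hwcast]
  have hw0 : w 0 = d := by simp [hw]
  have hws (n : ℕ) : w (n + 1) = a + (q + 1) ^ 2 * w n := geom_step (q + 1) a d n
  have hH (n : ℕ) : a * (q + 1 + (q + 1) ^ (2 * (n + 1))) +
      (q + 1) ^ (2 * (n + 1)) * (q * (q + 2)) * d =
      (q + 1) * (q + 2) * (a + (q + 1) * q * w n) := by
    have h3 : q * (q + 2) * w n + a = (a + q * (q + 2) * d) * (q + 1) ^ (2 * n) :=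
      geom_closed q a d n
    rw [mul_add 2 n 1, pow_add]
    calc a * (q + 1 + (q + 1) ^ (2 * n) * (q + 1) ^ (2 * 1)) +
          (q + 1) ^ (2 * n) * (q + 1) ^ (2 * 1) * (q * (q + 2)) * d =
        a * (q + 1) + (q + 1) ^ 2 * ((a + q * (q + 2) * d) * (q + 1) ^ (2 * n)) := by ring
      _ = _ := by rw [← h3]; ring
  have hpos : 0 < (q + 1) * (q + 2) := by positivity
  have hlt (n : ℕ) : w n < w (n + 1) := by
    have h3 : 1 * w n ≤ (q + 1) ^ 2 * w n := Nat.mul_le_mul_right _ (Nat.one_le_pow _ _ (by omega))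
    rw [hws]
    omega
  have hmono : Monotone w := monotone_nat_of_le_succ fun n => (hlt n).le
  have hstep {n : ℕ} (hn : V n = (w n : ℕ)) :
      (a + (q + 1) * q * w n ≤ b → ((w (n + 1) : ℕ) : ℕ∞) ≤ V (n + 1)) ∧
      (a + (q + 1) * q * w n < b → V (n + 1) = (w (n + 1) : ℕ)) := by
    have h3 := hV n
    have h4 : (b : ℕ∞) + (q + 1 : ℕ) * V n = ((b + (q + 1) * w n : ℕ) : ℕ∞) := by
      rw [hn]; push_cast; rfl
    have h5 : (a : ℕ∞) + (q + 1 : ℕ) ^ 2 * V n = ((w (n + 1) : ℕ) : ℕ∞) := by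
      rw [hn, hws]; push_cast; rfl
    rw [h4, h5] at h3
    have h6 : w (n + 1) = (a + (q + 1) * q * w n) + (q + 1) * w n := by rw [hws]; ring
    constructor
    · intro h7
      rw [min_eq_right (Nat.cast_le.2 (by omega))] at h3
      exact h3.1
    · intro h7
      rw [min_eq_right (Nat.cast_le.2 (by omega))] at h3
      exact h3.2 (by rw [Ne, Nat.cast_inj]; omega)
  -- The bound with `H_e` concerns the step from `e - 1` to `e`. Since `w` is strictly increasing,
  -- all earlier comparisons are strict and no tie occurs before `e`.
  have hlow (n : ℕ) (hn : n < e) : V n = (w n : ℕ) := by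
    induction n with
    | zero => rw [hw0, hd]
    | succ n ih =>
      refine (hstep (ih (by omega))).2 ?_
      obtain ⟨e', rfl⟩ : ∃ e', e = e' + 1 := ⟨e - 1, by omega⟩
      rw [hH] at h1
      have h3 := Nat.le_of_mul_le_mul_left h1 hpos
      have h4 : w (n + 1) ≤ w e' := hmono (by omega)
      have h5 := hlt n
      have h6 : (q + 1) * q * w n < (q + 1) * q * w e' :=
        Nat.mul_lt_mul_of_pos_left (by omega) (by positivity)
      omega
  have hbound : b < a + (q + 1) * q * w e := by
    rw [hH] at h2
    exact Nat.lt_of_mul_lt_mul_left h2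
  have hmid : ((w e : ℕ) : ℕ∞) ≤ V e := by
    rcases Nat.eq_zero_or_pos e with rfl | he
    · rw [hw0, hd]
    · obtain ⟨e', rfl⟩ : ∃ e', e = e' + 1 := ⟨e - 1, by omega⟩
      rw [hH] at h1
      exact (hstep (hlow e' (by omega))).1 (Nat.le_of_mul_le_mul_left h1 hpos)
  -- From `e` on, `V` stays at least `w e`, so the term with `b` is strictly smaller, unless `V` is
  -- infinite, where the formula is trivial.
  have hhigh (j : ℕ) : ((w e : ℕ) : ℕ∞) ≤ V (e + j) ∧
      V (e + (j + 1)) = b + (q + 1 : ℕ) * V (e + j) := by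
    have hnext {n : ℕ} (hn : ((w e : ℕ) : ℕ∞) ≤ V n) : V (n + 1) = b + (q + 1 : ℕ) * V n := by
      have h3 := hV n
      rcases eq_or_ne (V n) ⊤ with ht | ht
      · have h4 {m : ℕ} (hm : m ≠ 0) : ((m : ℕ) : ℕ∞) * ⊤ = ⊤ :=
          ENat.mul_top (by exact_mod_cast hm)
        have h5 : ((q + 1 : ℕ) : ℕ∞) ^ 2 = (((q + 1) ^ 2 : ℕ) : ℕ∞) := by push_cast; rfl
        rw [ht, h5, h4 (by omega), h4 (by positivity), add_top, add_top, min_self] at h3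
        rw [ht, h4 (by omega), add_top]
        exact top_le_iff.1 h3.1
      · obtain ⟨u, hu⟩ := ENat.ne_top_iff_exists.1 ht
        rw [← hu] at hn h3 ⊢
        have hn' : w e ≤ u := Nat.cast_le.1 hn
        have h4 : (b : ℕ∞) + (q + 1 : ℕ) * u = ((b + (q + 1) * u : ℕ) : ℕ∞) := by push_cast; rfl
        have h5 : (a : ℕ∞) + (q + 1 : ℕ) ^ 2 * u = ((a + (q + 1) ^ 2 * u : ℕ) : ℕ∞) := by
          push_cast; rfl
        have h6 : b + (q + 1) * u < a + (q + 1) ^ 2 * u := by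
          have h7 : (q + 1) * q * w e ≤ (q + 1) * q * u := Nat.mul_le_mul_left _ hn'
          nlinarith
        rw [h4, h5, min_eq_left (Nat.cast_le.2 h6.le)] at h3
        rw [h4]
        exact h3.2 (by rw [Ne, Nat.cast_inj]; omega)
    induction j with
    | zero => exact ⟨hmid, hnext hmid⟩
    | succ j ih =>
      have h3 : ((w e : ℕ) : ℕ∞) ≤ V (e + (j + 1)) := by
        rw [ih.2]
        refine ih.1.trans (le_trans ?_ le_add_self)
        exact le_mul_of_one_le_left' (by exact_mod_cast (show 1 ≤ q + 1 by omega))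
      exact ⟨h3, hnext h3⟩
  refine ⟨hlow, fun n hn => ?_, hmid, fun h3 => ?_⟩
  · obtain ⟨j, rfl⟩ := Nat.exists_eq_add_of_le hn
    rw [Nat.add_sub_cancel_left]
    clear hn
    induction j with
    | zero => simp
    | succ j ih => rw [(hhigh j).2, geom_step', ← ih]
  · rcases Nat.eq_zero_or_pos e with rfl | he
    · rw [hw0, hd]
    · obtain ⟨e', rfl⟩ : ∃ e', e = e' + 1 := ⟨e - 1, by omega⟩
      rw [hH] at h3
      exact (hstep (hlow e' (by omega))).2 (Nat.lt_of_mul_lt_mul_left h3)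

end recursion

/-! ### The smallest slope at the generic point -/

section products

variable {R : Type*} [CommRing R]

theorem prod_smul_vecMulVec {n₁ : Type*} [Fintype n₁] [DecidableEq n₁] (a : ℕ → R)
    (u w : ℕ → n₁ → R) (h : ∀ i, w i ⬝ᵥ u (i + 1) = 2) (n : ℕ) :
    ((List.range (n + 1)).map fun i => a i • Matrix.vecMulVec (u i) (w i)).prod =
      ((∏ i ∈ Finset.range (n + 1), a i) * 2 ^ n) • Matrix.vecMulVec (u 0) (w n) := by
  induction n with
  | zero => simp
  | succ n ih =>
    rw [List.range_succ, List.map_append, List.prod_append, ih, List.map_singleton,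
      List.prod_singleton, Matrix.smul_mul, Matrix.mul_smul, Matrix.vecMulVec_mul_vecMulVec, h,
      Matrix.vecMulVec_smul, smul_smul, smul_smul, Finset.prod_range_succ _ (n + 1), pow_succ]
    congr 1
    ring

theorem prod_blockTriangular {n₁ n₂ : Type*} [Fintype n₁] [DecidableEq n₁] [Fintype n₂]
    [DecidableEq n₂] {ι : Type*} (A : ι → Matrix n₁ n₁ R) (B : ι → Matrix n₁ n₂ R)
    (D : ι → Matrix n₂ n₂ R) (l : List ι) :
    ∃ B' D', (l.map fun i => Matrix.fromBlocks (A i) (B i) 0 (D i)).prod =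
      Matrix.fromBlocks (l.map A).prod B' 0 D' := by
  induction l with
  | nil => exact ⟨0, 1, by simp [Matrix.fromBlocks_one]⟩
  | cons i l ih =>
    obtain ⟨B', D', h⟩ := ih
    refine ⟨A i * B' + B i * D', D i * D', ?_⟩
    rw [List.map_cons, List.prod_cons, h, Matrix.fromBlocks_multiply, List.map_cons, List.prod_cons]
    simp only [Matrix.mul_zero, Matrix.zero_mul, add_zero, zero_add]

end products

/-! ### Nonvanishing of iterates of Frobenius at the generic point -/

section slopes

variable {p : ℕ} [Fact p.Prime] {k : Type*} [Field k] [CharP k p] {lam : k}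

variable (p k) in
/-- The embedding of constants `W → W(k((t))^perf)`. -/
def genericC : WittVector p k →+* WittVector p (GenericField p k) :=
  WittVector.map ((toGeneric p).comp (PowerSeries.C (R := k)))

/-- The Teichmüller lifts of the coordinates of the generic point of a curve. -/
def genericCoord (c : FormalCurve k) : Fin 3 → WittVector p (GenericField p k) :=
  fun i => WittVector.teichmuller p (toGeneric p (c.coord i))

theorem toGeneric_injective : Function.Injective (toGeneric p (k := k)) := by
  rw [toGeneric, RingHom.coe_comp]
  exact (RingHom.injective _).comp (IsFractionRing.injective k⟦X⟧ (LaurentSeries k))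

theorem constantCoeff_comp_genericC :
    (WittVector.constantCoeff (p := p)).comp (genericC p k) = (toGeneric p).comp (redC p k) := by
  ext1 a
  exact WittVector.map_coeff ((toGeneric p).comp (PowerSeries.C (R := k))) a 0

theorem constantCoeff_genericCoord (c : FormalCurve k) (i : Fin 3) :
    WittVector.constantCoeff (genericCoord (p := p) c i) = toGeneric p (c.coord i) :=
  WittVector.teichmuller_coeff_zero p _

theorem constantCoeff_beta (c : FormalCurve k) (i : ℕ) :
    WittVector.constantCoeff (beta p lam (genericC p k) (genericCoord c) i) =
      toGeneric p (beta p lam (redC p k) c.coord i) := by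
  rw [map_beta, map_beta, constantCoeff_comp_genericC]
  simp only [constantCoeff_genericCoord]

theorem constantCoeff_alpha (c : FormalCurve k) (i j : ℕ) :
    WittVector.constantCoeff (alpha p lam (genericC p k) (genericCoord c) i j) =
      toGeneric p (alpha p lam (redC p k) c.coord i j) := by
  rw [map_alpha, map_alpha, constantCoeff_comp_genericC]
  simp only [constantCoeff_genericCoord]

theorem constantCoeff_genericC_half_ne_zero [PerfectRing k p] (hp : p ≠ 2) :
    WittVector.constantCoeff (genericC p k (half p)) ≠ 0 := by
  intro h
  have h1 := congrArg (fun a => WittVector.constantCoeff (genericC p k a))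
    (half_mul_two (k := k) hp)
  simp only [map_mul, h, zero_mul, map_one, zero_ne_one] at h1

theorem constantCoeff_unit_ne_zero (h0 : lam ≠ 0) (i j : ℕ) :
    WittVector.constantCoeff
      (lamInvTwist p lam (genericC p k) i * lamTwist p lam (genericC p k) j) ≠ 0 := by
  have h1 (i : ℕ) : WittVector.constantCoeff (lamInvTwist p lam (genericC p k) i) *
      WittVector.constantCoeff (lamTwist p lam (genericC p k) i) = 1 := by
    rw [← map_mul, lamInvTwist_mul_lamTwist _ h0, map_one]
  rw [map_mul]
  exact mul_ne_zero (left_ne_zero_of_mul_eq_one (h1 i)) (right_ne_zero_of_mul_eq_one (h1 j))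

/-- If the matrices `K i` are block upper triangular modulo `p`, with upper left blocks that are nonzero
multiples of composable rank one matrices, then their products do not vanish modulo `p`. -/
theorem constantCoeff_entry_ne_zero (hp : p ≠ 2) (h0 : lam ≠ 0) (h : lam ^ p = -lam)
    {K : ℕ → Matrix Idx Idx (WittVector p (GenericField p k))}
    {a : ℕ → WittVector p (GenericField p k)} {s t : ℕ → ℕ} (hst : ∀ i, s (i + 1) = t i + 1)
    (ha : ∀ i, WittVector.constantCoeff (a i) ≠ 0)
    (h11 : ∀ i, (K i).toBlocks₁₁.map WittVector.constantCoeff =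
      (a i • Matrix.vecMulVec (colU p lam (genericC p k) (s i))
        (rowW p lam (genericC p k) (t i))).map WittVector.constantCoeff)
    (h21 : ∀ i, (K i).toBlocks₂₁.map WittVector.constantCoeff = 0) (n : ℕ) :
    WittVector.constantCoeff (((List.range n).map K).prod (Sum.inl 0) (Sum.inl 0)) ≠ 0 := by
  set φ : WittVector p (GenericField p k) →+* GenericField p k := WittVector.constantCoeff
  have h2 : φ 2 ≠ 0 := by rw [map_ofNat]; exact two_ne_zero_of_odd hp
  set Q : ℕ → Matrix (Fin 2) (Fin 2) (WittVector p (GenericField p k)) := fun i =>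
    a i • Matrix.vecMulVec (colU p lam (genericC p k) (s i)) (rowW p lam (genericC p k) (t i))
    with hQ
  have hK (i : ℕ) : (K i).map φ =
      Matrix.fromBlocks ((Q i).map φ) ((K i).toBlocks₁₂.map φ) 0 ((K i).toBlocks₂₂.map φ) := by
    conv_lhs => rw [← Matrix.fromBlocks_toBlocks (K i), Matrix.fromBlocks_map]
    rw [h11, h21]
  have hprod {m : Type} [Fintype m] [DecidableEq m]
      (L : ℕ → Matrix m m (WittVector p (GenericField p k))) :
      (((List.range n).map L).prod).map φ = ((List.range n).map fun i => (L i).map φ).prod := by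
    have := map_list_prod φ.mapMatrix ((List.range n).map L)
    rwa [List.map_map] at this
  obtain ⟨B', D', hBD⟩ := prod_blockTriangular (fun i => (Q i).map φ)
    (fun i => (K i).toBlocks₁₂.map φ) (fun i => (K i).toBlocks₂₂.map φ) (List.range n)
  have h3 : φ (((List.range n).map K).prod (Sum.inl 0) (Sum.inl 0)) =
      φ (((List.range n).map Q).prod 0 0) := by
    have h4 := hprod K
    simp only [hK, hBD] at h4
    have h5 := congrFun (congrFun h4 (Sum.inl 0)) (Sum.inl 0)
    rw [Matrix.fromBlocks_apply₁₁, ← hprod Q] at h5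
    exact h5
  rw [h3]
  cases n with
  | zero => simp
  | succ n =>
    rw [hQ, prod_smul_vecMulVec _ _ _ fun i => by
      rw [hst]; exact rowW_dotProduct_colU _ hp h0 h _]
    simp only [Matrix.smul_apply, Matrix.vecMulVec_apply, colU, rowW, Matrix.cons_val_zero, mul_one,
      smul_eq_mul, map_mul, map_prod, map_pow]
    exact mul_ne_zero (Finset.prod_ne_zero_iff.2 fun i _ => ha i) (pow_ne_zero _ h2)

theorem constantCoeff_natCast_mul (r : WittVector p (GenericField p k)) :
    WittVector.constantCoeff ((p : WittVector p (GenericField p k)) * r) = 0 := by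
  rw [map_mul, map_natCast, CharP.cast_eq_zero, zero_mul]

theorem map_natCast_smul_constantCoeff {n₁ n₂ : Type*}
    (L : Matrix n₁ n₂ (WittVector p (GenericField p k))) :
    ((p : WittVector p (GenericField p k)) • L).map WittVector.constantCoeff = 0 := by
  ext1 i j
  exact constantCoeff_natCast_mul _

theorem genericFrob_entry_of_beta_ne_zero [PerfectRing k p] (hp : p ≠ 2) (h0 : lam ≠ 0)
    (h : lam ^ p = -lam) {c : FormalCurve k} (hβ : beta p lam (redC p k) c.coord 0 ≠ 0) (n : ℕ) :
    WittVector.constantCoeff (genericFrob p lam c n (Sum.inl 0) (Sum.inl 0)) ≠ 0 := by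
  refine constantCoeff_entry_ne_zero (K := frobMatrix p lam (genericC p k) (genericCoord c))
    (a := fun i => genericC p k (half p) * beta p lam (genericC p k) (genericCoord c) i)
    (s := id) (t := id) hp h0 h (fun _ => rfl) (fun i => ?_) (fun i => ?_) (fun i => ?_) n
  · rw [map_mul, constantCoeff_beta, beta_eq_pow h]
    exact mul_ne_zero (constantCoeff_genericC_half_ne_zero hp)
      ((map_ne_zero_iff _ toGeneric_injective).2 (pow_ne_zero _ hβ))
  · rw [frobMatrix, Matrix.toBlocks_fromBlocks₁₁, Matrix.map_add _ (map_add _),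
      map_natCast_smul_constantCoeff, zero_add, matE_eq _ _ h0, smul_smul]
    rfl
  · rw [frobMatrix, Matrix.toBlocks_fromBlocks₂₁, map_natCast_smul_constantCoeff]

/-- Once `E = 0`, the product of two consecutive factors is divisible by `p`. The quotient is block
upper triangular modulo `p`, with upper left block `C B / 2`, of rank one with a nonzero multiple of
a twist of `α_{0,1}` as scalar. -/
theorem genericFrob_of_beta_eq_zero [PerfectRing k p] (hp : p ≠ 2) (h0 : lam ≠ 0)
    (h : lam ^ p = -lam) {c : FormalCurve k} (hβ : beta p lam (redC p k) c.coord 0 = 0)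
    (hα : alpha p lam (redC p k) c.coord 0 1 ≠ 0) (n : ℕ) :
    ∃ r : WittVector p (GenericField p k), WittVector.constantCoeff r ≠ 0 ∧
      genericFrob p lam c (2 * n) (Sum.inl 0) (Sum.inl 0) = p ^ n * r := by
  set F := genericC p k with hF
  set V := genericCoord (p := p) c with hV
  have hE (i : ℕ) : matE p lam F V i = 0 := by
    -- At Teichmüller coordinates `β_i` is a sum of two Teichmüller lifts. Their residues are
    -- opposite, so the sum vanishes exactly and not merely modulo `p`.
    have h1 : beta p lam F V i = 0 := by
      have h2 := constantCoeff_beta (p := p) (lam := lam) c i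
      rw [beta_eq_pow h, hβ, zero_pow (pow_pos (Fact.out : p.Prime).pos i).ne', map_zero] at h2
      rw [← hF, ← hV] at h2
      have h3 : beta p lam F V i = WittVector.teichmuller p
            (toGeneric p (c.coord 0) ^ p ^ i * toGeneric p (c.coord 1) ^ p ^ i) +
          WittVector.teichmuller p (toGeneric p (PowerSeries.C (4 * lam ^ 2)⁻¹) *
            (toGeneric p (c.coord 2) ^ p ^ i) ^ 2) := by
        simp only [beta, hV, genericCoord, map_mul, map_pow]
        rw [hF, genericC, WittVector.map_teichmuller]
        rfl
      rw [h3, map_add] at h2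
      have h4 : toGeneric p (PowerSeries.C (4 * lam ^ 2)⁻¹) *
            (toGeneric p (c.coord 2) ^ p ^ i) ^ 2 =
          -(toGeneric p (c.coord 0) ^ p ^ i * toGeneric p (c.coord 1) ^ p ^ i) := by
        refine eq_neg_of_add_eq_zero_right (Eq.trans ?_ h2)
        exact congrArg₂ _ (WittVector.teichmuller_coeff_zero p _).symm
          (WittVector.teichmuller_coeff_zero p _).symm
      rw [h3, h4, teichmuller_neg hp, add_neg_cancel]
    rw [matE, h1, zero_smul]
  set C := matC p lam F V
  set B := matB p lam F V
  set q : WittVector p (GenericField p k) := (p : WittVector p (GenericField p k)) with hq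
  set K : ℕ → Matrix Idx Idx (WittVector p (GenericField p k)) := fun i => Matrix.fromBlocks
    (q • 1 + F (half p) • (C (2 * i) * B (2 * i + 1)))
    (F (half p) • (C (2 * i + 1) + C (2 * i)))
    (q • (B (2 * i) + B (2 * i + 1)))
    (F (half p) • (B (2 * i) * C (2 * i + 1)) + q • 1) with hK
  have hpair (i : ℕ) : frobMatrix p lam F V (2 * i) * frobMatrix p lam F V (2 * i + 1) =
      q • K i := by
    simp only [frobMatrix, hE, smul_zero, add_zero, Matrix.fromBlocks_multiply, hK,
      Matrix.fromBlocks_smul, Matrix.smul_mul, Matrix.mul_smul, Matrix.one_mul, Matrix.mul_one,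
      smul_add]
    congr 1
    · congr 1
      rw [smul_comm]
    · congr 1
      rw [smul_comm]
  have hprod : genericFrob p lam c (2 * n) = q ^ n • ((List.range n).map K).prod := by
    change frobProd p lam F V (2 * n) = _
    rw [frobProd]
    induction n with
    | zero => simp
    | succ n ih =>
      rw [show 2 * (n + 1) = 2 * n + 1 + 1 by ring, List.range_succ, List.range_succ,
        List.range_succ]
      simp only [List.map_append, List.prod_append, List.map_singleton, List.prod_singleton]
      rw [Matrix.mul_assoc, hpair, ih, Matrix.mul_smul, Matrix.smul_mul, smul_smul, pow_succ']
  refine ⟨((List.range n).map K).prod (Sum.inl 0) (Sum.inl 0), ?_, ?_⟩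
  · refine constantCoeff_entry_ne_zero
      (a := fun i => F (half p) * (lamInvTwist p lam F (2 * i) * lamTwist p lam F (2 * i + 1) *
        alpha p lam F V (2 * i) (2 * i + 1)))
      (s := fun i => 2 * i) (t := fun i => 2 * i + 1) hp h0 h (fun _ => by ring)
      (fun i => ?_) (fun i => ?_) (fun i => ?_) n
    · rw [map_mul, map_mul, constantCoeff_alpha, alpha_add h]
      exact mul_ne_zero (constantCoeff_genericC_half_ne_zero hp)
        (mul_ne_zero (constantCoeff_unit_ne_zero h0 _ _)
          ((map_ne_zero_iff _ toGeneric_injective).2 (pow_ne_zero _ hα)))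
    · rw [hK, Matrix.toBlocks_fromBlocks₁₁, Matrix.map_add _ (map_add _),
        map_natCast_smul_constantCoeff, zero_add, matC_mul_matB _ _ h0, smul_smul]
    · rw [hK, Matrix.toBlocks_fromBlocks₂₁, map_natCast_smul_constantCoeff]
  · rw [hprod, Matrix.smul_apply, smul_eq_mul]

theorem emultiplicity_pow_mul_le {r : WittVector p (GenericField p k)}
    (hr : WittVector.constantCoeff r ≠ 0) (n : ℕ) :
    emultiplicity (p : WittVector p (GenericField p k)) (p ^ n * r) ≤ n := by
  refine Order.le_of_lt_add_one ?_
  have h1 : emultiplicity (p : WittVector p (GenericField p k)) (p ^ n * r) <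
      ((n + 1 : ℕ) : ℕ∞) := by
    rw [emultiplicity_lt_iff_not_dvd, pow_succ,
      mul_dvd_mul_iff_left (pow_ne_zero _ (WittVector.p_nonzero p _))]
    rintro ⟨s, rfl⟩
    exact hr (constantCoeff_natCast_mul s)
  exact_mod_cast h1

theorem slope_eq_zero_of_beta_ne_zero [PerfectRing k p] (hp : p ≠ 2) (h0 : lam ≠ 0)
    (h : lam ^ p = -lam) {c : FormalCurve k} (hβ : beta p lam (redC p k) c.coord 0 ≠ 0)
    {s : ℝ≥0∞} (hs : HasFirstSlope p lam c s) : s = 0 := by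
  refine tendsto_nhds_unique hs ?_
  refine tendsto_const_nhds.congr fun n => ?_
  have h1 : (⨅ i : Idx, ⨅ j : Idx, emultiplicity (p : WittVector p (GenericField p k))
      (genericFrob p lam c n i j) : ℕ∞) = 0 := by
    refine le_antisymm (iInf_le_of_le (Sum.inl 0) (iInf_le_of_le (Sum.inl 0) ?_)) bot_le
    have := emultiplicity_pow_mul_le (genericFrob_entry_of_beta_ne_zero hp h0 h hβ n) 0
    rwa [pow_zero, one_mul] at this
  rw [h1]
  simp

/-- The limit exists by hypothesis, so it may be bounded along the even iterates. -/
theorem slope_le_half_of_alpha_ne_zero [PerfectRing k p] (hp : p ≠ 2) (h0 : lam ≠ 0)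
    (h : lam ^ p = -lam) {c : FormalCurve k} (hβ : beta p lam (redC p k) c.coord 0 = 0)
    (hα : alpha p lam (redC p k) c.coord 0 1 ≠ 0)
    {s : ℝ≥0∞} (hs : HasFirstSlope p lam c s) : s ≤ 1 / 2 := by
  have h2 : Filter.Tendsto (fun n : ℕ => 2 * n) Filter.atTop Filter.atTop :=
    Filter.tendsto_id.const_mul_atTop' (by norm_num)
  refine le_of_tendsto (hs.comp h2) (Filter.Eventually.of_forall fun n => ?_)
  obtain ⟨r, hr, hrn⟩ := genericFrob_of_beta_eq_zero hp h0 h hβ hα n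
  have h1 : (⨅ i : Idx, ⨅ j : Idx, emultiplicity (p : WittVector p (GenericField p k))
      (genericFrob p lam c (2 * n) i j) : ℕ∞) ≤ n := by
    refine iInf_le_of_le (Sum.inl 0) (iInf_le_of_le (Sum.inl 0) ?_)
    rw [hrn]
    exact emultiplicity_pow_mul_le hr n
  refine ENNReal.div_le_of_le_mul ?_
  refine (ENat.toENNReal_mono h1).trans (le_of_eq ?_)
  rw [ENat.toENNReal_coe]
  push_cast
  rw [← mul_assoc, one_div, ENNReal.inv_mul_cancel (by norm_num) (by norm_num), one_mul]

end slopes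

/-! ### The supersingular locus -/

section supersingular

variable {p : ℕ} [Fact p.Prime] {k : Type*} [Field k] [CharP k p] {lam : k}

theorem alpha_comm {R : Type*} [CommRing R] (f : WittVector p k →+* R) (v : Fin 3 → R) (i j : ℕ) :
    alpha p lam f v i j = alpha p lam f v j i := by
  rw [alpha, alpha]
  ring

theorem alpha_zero_zero (hp : p ≠ 2) (v : Fin 3 → k⟦X⟧) :
    alpha p lam (redC p k) v 0 0 = 2 * beta p lam (redC p k) v 0 := by
  have h2 : (2 * lam ^ 2)⁻¹ = 2 * (4 * lam ^ 2)⁻¹ := by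
    have := two_ne_zero_of_odd (k := k) hp
    rw [mul_inv, mul_inv, ← mul_assoc, show (4 : k) = 2 * 2 by norm_num, mul_inv, ← mul_assoc,
      mul_inv_cancel₀ this, one_mul]
  rw [alpha, beta, redC_teichmuller, redC_teichmuller, h2, map_mul, map_ofNat]
  ring

theorem alpha_eq_zero (hp : p ≠ 2) (h : lam ^ p = -lam) {v : Fin 3 → k⟦X⟧}
    (hβ : beta p lam (redC p k) v 0 = 0) (hα : alpha p lam (redC p k) v 0 1 = 0) (i j : ℕ) :
    alpha p lam (redC p k) v i j = 0 := by
  wlog hij : i ≤ j generalizing i j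
  · rw [alpha_comm]
    exact this j i (le_of_not_ge hij)
  obtain ⟨d, rfl⟩ := Nat.exists_eq_add_of_le hij
  rw [alpha_add h]
  have hpi : p ^ i ≠ 0 := (pow_pos (Fact.out : p.Prime).pos i).ne'
  rcases Nat.eq_zero_or_pos d with rfl | hd
  · rw [alpha_zero_zero hp, hβ, mul_zero, zero_pow hpi]
  · have h1 := alpha_zero_mem hp h v ⊥ (by rw [hβ]; exact zero_mem _)
      (by rw [hα]; exact zero_mem _) hd
    rw [(Submodule.mem_bot _).1 h1, zero_pow hpi]

theorem locusOn_eq_zero [PerfectRing k p] (hp : p ≠ 2) (h0 : lam ≠ 0) (h : lam ^ p = -lam)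
    {c : FormalCurve k} (hβ : beta p lam (redC p k) c.coord 0 = 0)
    (hα : alpha p lam (redC p k) c.coord 0 1 = 0) (n : ℕ) (ω : Idx → ℤ_[p]) :
    locusOn lam c (n + 2) ω = 0 := by
  rw [← PowerSeries.order_eq_top, ← top_le_iff]
  refine ENat.forall_natCast_le_iff_le.1 fun D _ => ?_
  obtain ⟨M, -, hM⟩ := exists_X_pow_dvd_locusOn_sub_sum hp h0 h c n ω D
  rw [Finset.sum_eq_zero, sub_zero] at hM
  · exact X_pow_dvd_iff_le_order.1 hM
  · intro b _
    cases b with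
    | single i =>
      rw [weight, beta_eq_pow h, hβ, zero_pow (pow_pos (Fact.out : p.Prime).pos i).ne', zero_mul]
    | pair i j => rw [weight, alpha_eq_zero hp h hβ hα, mul_zero, zero_mul]

theorem natCast_dvd_of_map_eq_zero [PerfectRing k p] {g : (WittVector p k)⟦X⟧}
    (hg : PowerSeries.map WittVector.constantCoeff g = 0) : (p : (WittVector p k)⟦X⟧) ∣ g := by
  have h1 (m : ℕ) : (p : WittVector p k) ∣ PowerSeries.coeff m g := by
    rw [dvd_iff_constantCoeff, ← PowerSeries.coeff_map, hg, map_zero]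
  choose r hr using h1
  refine ⟨PowerSeries.mk r, ?_⟩
  ext1 m
  rw [← map_natCast (PowerSeries.C (R := WittVector p k)) p, PowerSeries.coeff_C_mul,
    PowerSeries.coeff_mk, hr]

theorem map_comp_C : (PowerSeries.map WittVector.constantCoeff).comp
    (PowerSeries.C (R := WittVector p k)) = redC p k := by
  ext1 a
  exact PowerSeries.map_C (WittVector.constantCoeff (p := p) (R := k)) a

/-- A vector whose last three coordinates are orthogonal, modulo `p`, to all the Frobenius twists of
the coordinates of the curve. -/
def TwistOrthogonal {R : Type*} [CommRing R] (v : Fin 3 → R) (s : Idx → R) : Prop :=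
  ∀ j, (p : R) ∣ rowV p v j ⬝ᵥ (s ∘ Sum.inr)

/-- The denominators of `F` meet only `β_i` and the pairing of the last three coordinates with the
twist `[i]`, both divisible by `p` here. The last three coordinates change by a multiple of `dualV`,
whose pairings are the `α_{j,i}`, so orthogonality persists and the step can be iterated. -/
theorem exists_frobMatrix_mulVec_eq {R : Type*} [CommRing R] (f : WittVector p k →+* R)
    (v : Fin 3 → R) (h0 : lam ≠ 0) (hα : ∀ i j, (p : R) ∣ alpha p lam f v i j)
    (hβ : ∀ i, (p : R) ∣ beta p lam f v i) (i : ℕ) {s : Idx → R}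
    (hs : TwistOrthogonal (p := p) v s) :
    ∃ s', TwistOrthogonal (p := p) v s' ∧
      (frobMatrix p lam f v i).mulVec s = (p : R) • s' := by
  obtain ⟨b, hb⟩ := hβ i
  obtain ⟨r, hr⟩ := hs i
  refine ⟨Sum.elim (s ∘ Sum.inl + ((f (half p) * (b * (rowW p lam f i ⬝ᵥ (s ∘ Sum.inl)))) •
      colU p lam f i) + ((f (half p) * (lamInvTwist p lam f i * r)) • colU p lam f i))
    ((lamTwist p lam f i * (rowW p lam f i ⬝ᵥ (s ∘ Sum.inl))) • dualV p lam f v i + s ∘ Sum.inr),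
    fun j => ?_, ?_⟩
  · rw [Sum.elim_comp_inr, dotProduct_add, dotProduct_smul, rowV_dotProduct_dualV, smul_eq_mul]
    exact dvd_add (Dvd.dvd.mul_left (hα _ _) _) (hs j)
  · rw [frobMatrix, Matrix.fromBlocks_mulVec, matE_eq _ _ h0, matC_eq _ _ h0, matB_eq _ _ h0]
    simp only [Matrix.add_mulVec, Matrix.smul_mulVec, Matrix.one_mulVec, Matrix.vecMulVec_mulVec,
      hb, hr]
    funext a
    rcases a with a | a <;>
      simp only [Sum.elim_inl, Sum.elim_inr, Pi.add_apply, Pi.smul_apply, smul_eq_mul,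
        MulOpposite.smul_eq_mul_unop, MulOpposite.unop_op, Function.comp_apply] <;>
      ring

theorem exists_prod_mulVec_eq {R : Type*} [CommRing R] (f : WittVector p k →+* R)
    (v : Fin 3 → R) (h0 : lam ≠ 0) (hα : ∀ i j, (p : R) ∣ alpha p lam f v i j)
    (hβ : ∀ i, (p : R) ∣ beta p lam f v i) (l : List ℕ) {s : Idx → R}
    (hs : TwistOrthogonal (p := p) v s) :
    ∃ s', TwistOrthogonal (p := p) v s' ∧
      ((l.map (frobMatrix p lam f v)).prod).mulVec s = (p : R) ^ l.length • s' := by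
  induction l with
  | nil => exact ⟨s, hs, by simp⟩
  | cons i l ih =>
    obtain ⟨s', hs', h1⟩ := ih
    obtain ⟨s'', hs'', h2⟩ := exists_frobMatrix_mulVec_eq f v h0 hα hβ i hs'
    refine ⟨s'', hs'', ?_⟩
    rw [List.map_cons, List.prod_cons, ← Matrix.mulVec_mulVec, h1, Matrix.mulVec_smul, h2,
      smul_smul, List.length_cons, pow_succ]

theorem inPDEnvelope_map {N : ℕ} (g : (WittVector p k)⟦X⟧) :
    InPDEnvelope p N (PowerSeries.map (algebraMap (WittVector p k) (FracW p k)) g) := by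
  refine ⟨fun κ => if κ = 0 then g else 0, fun r => ⟨1, fun κ hκ m => ?_⟩, fun m => ?_⟩
  · simp only [show κ ≠ 0 by omega, if_false, map_zero]
    exact dvd_zero _
  · rw [Finset.sum_eq_single 0]
    · simp
    · intro κ _ hκ
      simp [hκ]
    · simp

/-- The integral quotients `S m` need not be compatible for different `m`: only the `m`-th
coefficient of each is used. -/
theorem horizontalSection_eq_map (v : Fin 3 → (WittVector p k)⟦X⟧) (ω : Idx → ℤ_[p])
    {S : ℕ → Idx → (WittVector p k)⟦X⟧}
    (hS : ∀ m, (frobProd p lam (PowerSeries.C (R := WittVector p k)) v (m + 1)).mulVec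
      (fun j => PowerSeries.C (zpToW p (ω j))) = (p : (WittVector p k)⟦X⟧) ^ (m + 1) • S m)
    (a : Idx) :
    horizontalSection p lam v ω a = PowerSeries.map (algebraMap (WittVector p k) (FracW p k))
      (PowerSeries.mk fun m => PowerSeries.coeff m (S m a)) := by
  ext1 m
  have h1 : PowerSeries.coeff m ((p : (WittVector p k)⟦X⟧) ^ (m + 1) * S m a) =
      (p : WittVector p k) ^ (m + 1) * PowerSeries.coeff m (S m a) := by
    rw [← map_natCast (PowerSeries.C (R := WittVector p k)) p, ← map_pow, PowerSeries.coeff_C_mul]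
  have h2 : (p : FracW p k) ^ (m + 1) ≠ 0 :=
    pow_ne_zero _ (WittVector.FractionRing.p_nonzero p k)
  rw [horizontalSection, PowerSeries.coeff_mk, PowerSeries.coeff_map, PowerSeries.coeff_mk,
    hS, Pi.smul_apply, smul_eq_mul, h1, map_mul, map_pow, map_natCast, mul_div_cancel_left₀ _ h2]

/-- This starts the induction, and is where the factor `p` in `p ω` is used. -/
theorem twistOrthogonal_p_smul {R : Type*} [CommRing R] (v : Fin 3 → R) (s : Idx → R) :
    TwistOrthogonal (p := p) v ((p : R) • s) := by
  intro j
  rw [Pi.smul_comp, dotProduct_smul]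
  exact dvd_mul_right _ _

theorem C_zpToW_p_smul (ω : Idx → ℤ_[p]) :
    (fun j => PowerSeries.C (zpToW p (((p : ℤ_[p]) • ω) j)) : Idx → (WittVector p k)⟦X⟧) =
      (p : (WittVector p k)⟦X⟧) • fun j => PowerSeries.C (zpToW p (ω j)) := by
  have h1 (a : ℤ_[p]) : zpToW (k := k) p ((p : ℤ_[p]) * a) = (p : WittVector p k) * zpToW p a := by
    rw [map_mul, map_natCast]
  have h2 (a : WittVector p k) : PowerSeries.C ((p : WittVector p k) * a) =
      (p : (WittVector p k)⟦X⟧) * PowerSeries.C a := by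
    rw [map_mul, map_natCast]
  funext j
  exact (congrArg _ (h1 _)).trans (h2 _)

/-- For any lift of the curve all `α_{i,j}` and `β_i` are divisible by `p`. The section is then a
power series over `W`, which lies in the envelope of `(p, t^N)` for every `N` at once. -/
theorem neverDecays_of_eq_zero [PerfectRing k p] (hp : p ≠ 2) (h0 : lam ≠ 0) (h : lam ^ p = -lam)
    {c : FormalCurve k} (hβ : beta p lam (redC p k) c.coord 0 = 0)
    (hα : alpha p lam (redC p k) c.coord 0 1 = 0) (ω : Idx → ℤ_[p]) :
    NeverDecays p lam c ((p : ℤ_[p]) • ω) := by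
  intro N _ v _ hv
  have hα' (i j : ℕ) : (p : (WittVector p k)⟦X⟧) ∣ alpha p lam PowerSeries.C v i j := by
    apply natCast_dvd_of_map_eq_zero
    rw [map_alpha, map_comp_C]
    simp only [hv]
    exact alpha_eq_zero hp h hβ hα i j
  have hβ' (i : ℕ) : (p : (WittVector p k)⟦X⟧) ∣ beta p lam PowerSeries.C v i := by
    apply natCast_dvd_of_map_eq_zero
    rw [map_beta, map_comp_C]
    simp only [hv]
    rw [beta_eq_pow h, hβ, zero_pow (pow_pos (Fact.out : p.Prime).pos i).ne']
  have hint (m : ℕ) : ∃ s', (frobProd p lam (PowerSeries.C (R := WittVector p k)) v (m + 1)).mulVec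
      (fun j => PowerSeries.C (zpToW p (((p : ℤ_[p]) • ω) j))) =
        (p : (WittVector p k)⟦X⟧) ^ (m + 1) • s' := by
    rw [C_zpToW_p_smul]
    obtain ⟨s', -, h1⟩ := exists_prod_mulVec_eq _ v h0 hα' hβ' (List.range (m + 1))
      (twistOrthogonal_p_smul v _)
    rw [List.length_range] at h1
    exact ⟨s', h1⟩
  choose S hS using hint
  have hs := horizontalSection_eq_map v ((p : ℤ_[p]) • ω) hS
  have hp' : (p : (FracW p k)⟦X⟧) =
      PowerSeries.map (algebraMap (WittVector p k) (FracW p k)) (p : (WittVector p k)⟦X⟧) :=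
    (map_natCast _ p).symm
  have hL : PowerSeries.C (algebraMap (WittVector p k) (FracW p k)
      (WittVector.teichmuller p lam)) = PowerSeries.map (algebraMap (WittVector p k) (FracW p k))
        (PowerSeries.C (WittVector.teichmuller p lam)) := (PowerSeries.map_C _ _).symm
  refine ⟨?_, ?_, fun j => ?_⟩
  · rw [hs, hs, hL, hp', ← map_mul, ← map_add, ← map_mul]
    exact inPDEnvelope_map _
  · rw [hs, hs, hL, ← map_mul, ← map_sub]
    exact inPDEnvelope_map _
  · rw [hs]
    exact inPDEnvelope_map _

end supersingular

/-! ### From orders of power series to intersection numbers -/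

section comparison

variable {p : ℕ} [Fact p.Prime] {k : Type*} [Field k] [CharP k p] {lam : k}

theorem one_le_numA (lam : k) (c : FormalCurve k) : 1 ≤ numA p lam c := by
  rw [numA_eq, PowerSeries.one_le_order_iff_constCoeff_eq_zero]
  have h1 (i : Fin 3) (j : ℕ) : PowerSeries.constantCoeff (c.coord i) ^ p ^ j = 0 := by
    rw [c.coord_zero, zero_pow (pow_pos (Fact.out : p.Prime).pos j).ne']
  simp only [alpha, map_add, map_mul, map_pow, h1, mul_zero, add_zero]

theorem one_le_meetLocus (lam : k) (c : FormalCurve k) (n : ℕ) (ω : Idx → ℤ_[p]) :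
    1 ≤ meetLocus p lam c (n + 1) ω := by
  have h1 := X_dvd_locusOn lam c n ω
  rw [← pow_one (PowerSeries.X : k⟦X⟧), X_pow_dvd_iff_le_order, order_locusOn] at h1
  exact_mod_cast h1

theorem meetLocus_recursion [PerfectRing k p] (hp : p ≠ 2) (h0 : lam ≠ 0) (h : lam ^ p = -lam)
    (c : FormalCurve k) (ω : Idx → ℤ_[p]) (n : ℕ) :
    min (numB p lam c + p * meetLocus p lam c (n + 1) ω)
        (numA p lam c + p ^ 2 * meetLocus p lam c (n + 1) ω) ≤ meetLocus p lam c (n + 2) ω ∧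
      (numB p lam c + p * meetLocus p lam c (n + 1) ω ≠
        numA p lam c + p ^ 2 * meetLocus p lam c (n + 1) ω →
        meetLocus p lam c (n + 2) ω = min (numB p lam c + p * meetLocus p lam c (n + 1) ω)
          (numA p lam c + p ^ 2 * meetLocus p lam c (n + 1) ω)) := by
  have h1 := one_le_meetLocus lam c n ω
  rw [← order_locusOn] at h1
  have h2 := min_le_order_of_recursion hp h0 h c.coord h1
    (exists_X_pow_dvd_locusOn_sub_sum hp h0 h c n ω)
  rwa [← numA_eq, ← numB_eq, order_locusOn, order_locusOn] at h2

/-- Multiplying by `p` clears the exponent `-1` that occurs for `e = 0`, so the comparison can be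
made between natural numbers. -/
theorem numH_mul {c : FormalCurve k} {ω : Idx → ℤ_[p]} {q a d : ℕ} (hq : p = q + 1)
    (ha : numA p lam c = a) (hd : numd p lam c ω = d) (e : ℕ) :
    numH p lam c ω e * p =
      ((a * (q + 1 + (q + 1) ^ (2 * e)) + (q + 1) ^ (2 * e) * (q * (q + 2)) * d : ℕ) : ℝ≥0∞) := by
  have hp0 : (p : ℝ≥0∞) ≠ 0 := by exact_mod_cast (Fact.out : p.Prime).ne_zero
  have h1 : (p : ℝ≥0∞) ^ (2 * (e : ℤ) - 1) * p = p ^ (2 * e) := by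
    have h3 := ENNReal.zpow_add hp0 (ENNReal.natCast_ne_top p) (2 * (e : ℤ) - 1) 1
    rw [zpow_one, sub_add_cancel] at h3
    rw [← h3]
    exact_mod_cast zpow_natCast (p : ℝ≥0∞) (2 * e)
  have h2 : (p : ℝ≥0∞) ^ 2 - 1 = ((q * (q + 2) : ℕ) : ℝ≥0∞) := by
    have h3 : (p : ℝ≥0∞) ^ 2 = ((q * (q + 2) : ℕ) : ℝ≥0∞) + 1 := by
      rw [hq]; push_cast; ring
    rw [h3, ENNReal.add_sub_cancel_right ENNReal.one_ne_top]
  rw [numH, ha, hd, h2]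
  simp only [ENat.toENNReal_coe]
  calc ((a : ℝ≥0∞) * (1 + (p : ℝ≥0∞) ^ (2 * (e : ℤ) - 1)) +
        (p : ℝ≥0∞) ^ (2 * (e : ℤ) - 1) * ((q * (q + 2) : ℕ) : ℝ≥0∞) * d) * p =
      a * (p + (p : ℝ≥0∞) ^ (2 * (e : ℤ) - 1) * p) +
        ((p : ℝ≥0∞) ^ (2 * (e : ℤ) - 1) * p) * ((q * (q + 2) : ℕ) : ℝ≥0∞) * d := by ring
    _ = _ := by rw [h1, hq]; push_cast; ring

end comparison

/-! ### The three Newton strata -/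

section strata

variable {p : ℕ} [Fact p.Prime] {k : Type*} [Field k] [CharP k p] {lam : k}

theorem supersingular_case [PerfectRing k p] (hp : p ≠ 2) (h0 : lam ≠ 0) (h : lam ^ p = -lam)
    {c : FormalCurve k} (hs : GenericallySupersingular p lam c) (ω : Idx → ℤ_[p]) :
    NeverDecays p lam c ((p : ℤ_[p]) • ω) ∧ meetLocus p lam c 1 ((p : ℤ_[p]) • ω) = ⊤ ∧
      ∀ n : ℕ, 1 ≤ n → meetLocus p lam c (n + 1) ω = ⊤ := by
  have hβ : beta p lam (redC p k) c.coord 0 = 0 := by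
    by_contra hβ
    exact one_ne_zero (slope_eq_zero_of_beta_ne_zero hp h0 h hβ hs)
  have hα : alpha p lam (redC p k) c.coord 0 1 = 0 := by
    by_contra hα
    have h1 := slope_le_half_of_alpha_ne_zero hp h0 h hβ hα hs
    rw [one_div, ENNReal.one_le_inv] at h1
    exact absurd h1 (by norm_num)
  have hT (n : ℕ) : meetLocus p lam c (n + 2) ω = ⊤ := by
    rw [← order_locusOn, locusOn_eq_zero hp h0 h hβ hα, PowerSeries.order_zero]
  refine ⟨neverDecays_of_eq_zero hp h0 h hβ hα ω, ?_, fun n hn => ?_⟩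
  · rw [meetLocus, locusEq, ← zero_add 1, seriesG_p_smul]
    exact hT 0
  · obtain ⟨m, rfl⟩ := Nat.exists_eq_add_of_le' hn
    exact hT m

theorem almostOrdinary_case [PerfectRing k p] (hp : p ≠ 2) (h0 : lam ≠ 0) (h : lam ^ p = -lam)
    {c : FormalCurve k} (hs : GenericallyAlmostOrdinary p lam c) (ω : Idx → ℤ_[p]) (n : ℕ) :
    meetLocus p lam c (n + 1) ω = numA p lam c * ∑ i ∈ Finset.range n, (p : ℕ∞) ^ (2 * i) +
      numd p lam c ω * (p : ℕ∞) ^ (2 * n) := by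
  have hβ : beta p lam (redC p k) c.coord 0 = 0 := by
    by_contra hβ
    have h1 := slope_eq_zero_of_beta_ne_zero hp h0 h hβ hs
    simp at h1
  have hB : numB p lam c = ⊤ := by rw [numB_eq, hβ, PowerSeries.order_zero]
  refine order_eq_of_top (V := fun n => meetLocus p lam c (n + 1) ω) (fun n => ?_) n
  rw [← hB]
  exact meetLocus_recursion hp h0 h c ω n

theorem ordinary_case [PerfectRing k p] (hp : p ≠ 2) (h0 : lam ≠ 0) (h : lam ^ p = -lam)
    {c : FormalCurve k} (ω : Idx → ℤ_[p]) (e : ℕ)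
    (h1 : numH p lam c ω e ≤ (1 + (p : ℝ≥0∞)) * (numB p lam c : ℝ≥0∞))
    (h2 : (1 + (p : ℝ≥0∞)) * (numB p lam c : ℝ≥0∞) < numH p lam c ω (e + 1)) :
    (∀ n : ℕ, n < e → meetLocus p lam c (n + 1) ω =
      numA p lam c * ∑ i ∈ Finset.range n, (p : ℕ∞) ^ (2 * i)
        + numd p lam c ω * (p : ℕ∞) ^ (2 * n)) ∧
    (∀ n : ℕ, e ≤ n → meetLocus p lam c (n + 1) ω =
      numB p lam c * ∑ i ∈ Finset.range (n - e), (p : ℕ∞) ^ i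
        + meetLocus p lam c (e + 1) ω * (p : ℕ∞) ^ (n - e)) ∧
    numA p lam c * ∑ i ∈ Finset.range e, (p : ℕ∞) ^ (2 * i)
        + numd p lam c ω * (p : ℕ∞) ^ (2 * e) ≤ meetLocus p lam c (e + 1) ω ∧
    (numH p lam c ω e < (1 + (p : ℝ≥0∞)) * (numB p lam c : ℝ≥0∞) →
      meetLocus p lam c (e + 1) ω =
        numA p lam c * ∑ i ∈ Finset.range e, (p : ℕ∞) ^ (2 * i)
          + numd p lam c ω * (p : ℕ∞) ^ (2 * e)) := by
  have hp2 := (Fact.out : p.Prime).two_le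
  obtain ⟨q, hq⟩ : ∃ q, p = q + 1 := ⟨p - 1, by omega⟩
  have hp0 : (p : ℝ≥0∞) ≠ 0 := by exact_mod_cast (Fact.out : p.Prime).ne_zero
  have hptop : (p : ℝ≥0∞) ≠ ⊤ := ENNReal.natCast_ne_top p
  have hz (m : ℤ) : (p : ℝ≥0∞) ^ m ≠ 0 := (ENNReal.zpow_pos hp0 hptop m).ne'
  -- The strict upper bound makes `B` and `H_e` finite. The coefficients of `A` and `d` in `H_e` are
  -- nonzero, so these are finite as well.
  have hH := (h1.trans_lt h2).ne_top
  have hB : numB p lam c ≠ ⊤ := by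
    intro hB
    rw [hB, ENat.toENNReal_top, ENNReal.mul_top (by simp)] at h2
    exact not_top_lt h2
  have hA : numA p lam c ≠ ⊤ := by
    intro hA
    apply hH
    rw [numH, hA, ENat.toENNReal_top, ENNReal.top_mul (by simp), top_add]
  have hp1 : (p : ℝ≥0∞) ^ 2 - 1 ≠ 0 := by
    rw [Ne, tsub_eq_zero_iff_le, not_le]
    exact one_lt_pow₀ (by exact_mod_cast hp2) two_ne_zero
  have hd : numd p lam c ω ≠ ⊤ := by
    intro hd
    apply hH
    rw [numH, hd, ENat.toENNReal_top, ENNReal.mul_top (mul_ne_zero (hz _) hp1), add_top]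
  obtain ⟨a, ha⟩ := ENat.ne_top_iff_exists.1 hA
  obtain ⟨b, hb⟩ := ENat.ne_top_iff_exists.1 hB
  obtain ⟨d, hd⟩ := ENat.ne_top_iff_exists.1 hd
  have hB' : (1 + (p : ℝ≥0∞)) * (numB p lam c : ℝ≥0∞) * p =
      (((q + 1) * (q + 2) * b : ℕ) : ℝ≥0∞) := by
    rw [← hb, ENat.toENNReal_coe, hq]
    push_cast
    ring
  have hmul {x y : ℝ≥0∞} : x * p < y * p ↔ x < y := ENNReal.mul_lt_mul_iff_left hp0 hptop
  rw [← not_lt, ← hmul, numH_mul hq ha.symm hd.symm, hB', Nat.cast_lt, not_lt] at h1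
  rw [← hmul, numH_mul hq ha.symm hd.symm, hB', Nat.cast_lt] at h2
  rw [← hmul (x := numH p lam c ω e), numH_mul hq ha.symm hd.symm, hB', Nat.cast_lt]
  have ha1 : 1 ≤ a := by
    have := one_le_numA (p := p) lam c
    rw [← ha] at this
    exact_mod_cast this
  have key := order_cases (V := fun n => meetLocus p lam c (n + 1) ω) (q := q) (a := a) (b := b)
    (d := d) (e := e) (by omega) ha1 hd.symm (fun n => by
      rw [← hq, ha, hb]
      exact meetLocus_recursion hp h0 h c ω n) h1 h2
  rw [← hq, ha, hb] at key
  rw [← hq]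
  exact key

end strata

end

end SuperspecialDecay

theorem proposition3p13 (p : ℕ) [Fact p.Prime] (hp : p ≠ 2)
    {k : Type*} [Field k] [CharP k p] [IsAlgClosed k]
    (eps : ZMod p) (heps : ¬ IsSquare eps)
    (lam : k) (hlam : lam ^ 2 = ZMod.castHom (dvd_refl p) k eps)
    (c : FormalCurve k) (ω : Idx → ℤ_[p]) :
    (GenericallySupersingular p lam c →
      NeverDecays p lam c ((p : ℤ_[p]) • ω) ∧
      meetLocus p lam c 1 ((p : ℤ_[p]) • ω) = ⊤ ∧
      ∀ n : ℕ, 1 ≤ n → meetLocus p lam c (n + 1) ω = ⊤) ∧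
    (GenericallyAlmostOrdinary p lam c → ∀ n : ℕ,
      meetLocus p lam c (n + 1) ω =
        numA p lam c * ∑ i ∈ Finset.range n, (p : ℕ∞) ^ (2 * i)
          + numd p lam c ω * (p : ℕ∞) ^ (2 * n)) ∧
    (GenericallyOrdinary p lam c → ∀ e : ℕ,
      numH p lam c ω e ≤ (1 + (p : ℝ≥0∞)) * (numB p lam c : ℝ≥0∞) →
      (1 + (p : ℝ≥0∞)) * (numB p lam c : ℝ≥0∞) < numH p lam c ω (e + 1) →
      (∀ n : ℕ, n < e → meetLocus p lam c (n + 1) ω =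
        numA p lam c * ∑ i ∈ Finset.range n, (p : ℕ∞) ^ (2 * i)
          + numd p lam c ω * (p : ℕ∞) ^ (2 * n)) ∧
      (∀ n : ℕ, e ≤ n → meetLocus p lam c (n + 1) ω =
        numB p lam c * ∑ i ∈ Finset.range (n - e), (p : ℕ∞) ^ i
          + meetLocus p lam c (e + 1) ω * (p : ℕ∞) ^ (n - e)) ∧
      numA p lam c * ∑ i ∈ Finset.range e, (p : ℕ∞) ^ (2 * i)
          + numd p lam c ω * (p : ℕ∞) ^ (2 * e) ≤ meetLocus p lam c (e + 1) ω ∧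
      (numH p lam c ω e < (1 + (p : ℝ≥0∞)) * (numB p lam c : ℝ≥0∞) →
        meetLocus p lam c (e + 1) ω =
          numA p lam c * ∑ i ∈ Finset.range e, (p : ℕ∞) ^ (2 * i)
            + numd p lam c ω * (p : ℕ∞) ^ (2 * e))) := by
  have h := pow_char_eq_neg hp heps hlam
  have h0 := ne_zero_of_sq_eq heps hlam
  exact ⟨fun hs => supersingular_case hp h0 h hs ω,
    fun hs n => almostOrdinary_case hp h0 h hs ω n,
    fun _ e h1 h2 => ordinary_case hp h0 h ω e h1 h2⟩
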